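/- A meandric system on $2n$ points is a pair of non-crossing pair partitions of $\{1,\dots,2n\}$, one drawn as arches above a horizontal line through the points and one drawn below it; its loops are the closed curves formed by the arches of both. Let $M_n^{(k)}$ be the number of meandric systems on $2n$ points with exactly $k$ loops, and for $r \ge 1$ consider the formal power series $$F_r(t) = \sum_{n=r+1}^\infty M_n^{(n-r)}\, t^n .$$ Theorem. For every fixed integer $r \ge 1$ there exists a polynomial $\tilde P_r$ with rational coefficients, of degree at most $3r-3$, such that under the change of variables $t = w/(1+w)^2$ the following identity of formal power series in $w$ holds: $$F_r\!\left(\frac{w}{(1+w)^2}\right) = \sum_{n=r+1}^\infty M_n^{(n-r)} \frac{w^n}{(1+w)^{2n}} = \frac{w^{r+1}(1+w)}{(1-w)^{2r-1}}\, \tilde P_r(w).$$ -/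

import Mathlib

open scoped PowerSeries

/-- A non-crossing pair partition of the points `0 < 1 < ⋯ < m - 1` of a line, given by the
involution without fixed points that swaps the two elements of every block. Non-crossing means
that there are no two blocks `{a, b}`, `{c, d}` with `a < c < b < d`. -/
def IsNonCrossingPairing {m : ℕ} (σ : Equiv.Perm (Fin m)) : Prop :=
  (∀ i, σ (σ i) = i) ∧ (∀ i, σ i ≠ i) ∧ ∀ a c, ¬ (a < c ∧ c < σ a ∧ σ a < σ c)

/-- A meandric system on `2n` points: a non-crossing pairing drawn above the line and one drawn
below it. -/
structure MeandricSystem (n : ℕ) where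
  /-- The arches above the line. -/
  upper : Equiv.Perm (Fin (2 * n))
  /-- The arches below the line. -/
  lower : Equiv.Perm (Fin (2 * n))
  upper_nc : IsNonCrossingPairing upper
  lower_nc : IsNonCrossingPairing lower

/-- The graph on the `2n` points in which two points are adjacent when they are joined by an upper
or by a lower arch. -/
def MeandricSystem.graph {n : ℕ} (S : MeandricSystem n) : SimpleGraph (Fin (2 * n)) :=
  SimpleGraph.fromRel (fun i j => S.upper i = j ∨ S.lower i = j)

/-- The number of loops: following upper and lower arches alternately, the points on one loop are
exactly the points of one connected component of the graph of arches. -/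
noncomputable def MeandricSystem.loops {n : ℕ} (S : MeandricSystem n) : ℕ :=
  Nat.card S.graph.ConnectedComponent

/-- `meandricNumber n k` is the number `M_n^{(k)}` of meandric systems on `2n` points with `k`
loops. -/
noncomputable def meandricNumber (n k : ℕ) : ℕ :=
  Nat.card {S : MeandricSystem n // S.loops = k}

/-- The generating function `F_r(t) = ∑_{n ≥ r + 1} M_n^{(n - r)} t ^ n`. -/
noncomputable def meandricSeries (r : ℕ) : ℚ⟦X⟧ :=
  PowerSeries.mk fun n => if r + 1 ≤ n then (meandricNumber n (n - r) : ℚ) else 0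

/-- The formal power series `w / (1 + w) ^ 2` in the variable `w`. -/
noncomputable def changeOfVariable : ℚ⟦X⟧ :=
  PowerSeries.X * ((1 + PowerSeries.X) ^ 2)⁻¹

/-- The series `w / (1 + w) ^ 2` has zero constant term, so that it can be substituted into any
formal power series. -/
theorem hasSubst_changeOfVariable : PowerSeries.HasSubst changeOfVariable := by
  apply PowerSeries.HasSubst.of_constantCoeff_zero'
  simp [changeOfVariable]

/-!
A meandric system is encoded by the word whose letter at a point records, above and below the line,
whether an arch starts or ends there. Non-crossing pairings correspond to balanced bracket words
(`arcWord_injective`, `IsBalanced.exists_pairing`), so these words are the lists `w` of pairs of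
brackets with both components balanced (`IsSystemWord`), and a factor of `w` that is again such a
word is an interval of points that is a union of loops. Inserting one system into a gap of another
one adds up the numbers of loops (`wordLoops_insert`).

Call a nonempty system irreducible if no proper interval of its points is a union of loops. Every
nonempty system arises in a unique way from an irreducible one by inserting an arbitrary system,
possibly empty, after each of its points (`exists_irreducible_fill`, `fill_injective`): the inserted
words are the longest system words that can be read off from left to right. Hence the generating
function `M = ∑ q ^ (n - k) * t ^ n` of the systems with `2 * n` points and `k` loops satisfies
`M = 1 + ∑ q ^ e * (t * M ^ 2) ^ m`, where the sum is over the irreducible systems with `2 * m`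
points and `m - e` loops (`coeff_systemGenFun`). One of them is the circle, with `m = 1`, `e = 0`.
In all others every loop has at least four points (`IsIrreducibleWord.four_mul_wordLoops_le`), so
that `e + 1 ≤ m ≤ 2 * e`, and there are only finitely many for every `e`.

Put `t = w / (1 + w) ^ 2` and `M = (1 + w) * Y`. Then `t * M ^ 2 = w * Y ^ 2`, and the coefficient
of `q ^ 0` gives `Y₀ = 1`. The coefficient of `q ^ r` gives `(1 - w) * Y_r` as the sum of
`w * Y_i * Y_(r - i)` over `0 < i < r` and of `w ^ m` times the coefficient of `q ^ (r - e)` in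
`Y ^ (2 * m)`, over finitely many pairs `e < m ≤ 2 * e`. By induction on `r` this has the form
`w ^ (r + 1) * (1 - w) ^ (2 - 2 * r) * P` with a polynomial `P` of degree at most `3 * r - 3`
(`isReducedPiece_of_equation`), and `(1 + w) * Y_r` is the series of the theorem.
-/

/-! ### Balanced words -/

/-- The contribution of a bracket to the height of a word: `true` opens an arch and `false` closes
one. -/
def stepSign (b : Bool) : ℤ := if b then 1 else -1

/-- The number of opening brackets of a word minus the number of closing ones. -/
def height (l : List Bool) : ℤ := (l.map stepSign).sum

@[simp] lemma height_nil : height [] = 0 := rfl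

@[simp] lemma height_cons (b : Bool) (l : List Bool) :
    height (b :: l) = stepSign b + height l := by simp [height]

@[simp] lemma height_append (l l' : List Bool) : height (l ++ l') = height l + height l' := by
  simp [height]

/-- A balanced bracket word (Dyck word): its height is zero and no prefix has negative height. -/
def IsBalanced (l : List Bool) : Prop := height l = 0 ∧ ∀ p q, l = p ++ q → 0 ≤ height p

lemma isBalanced_nil : IsBalanced [] := by
  refine ⟨rfl, fun p q h => ?_⟩
  obtain ⟨rfl, rfl⟩ := List.append_eq_nil_iff.1 h.symm
  simp

lemma isBalanced_insert_iff {u : List Bool} (hu : IsBalanced u) (x y : List Bool) :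
    IsBalanced (x ++ u ++ y) ↔ IsBalanced (x ++ y) := by
  have h0 := hu.1
  refine and_congr (by simp [h0]) ⟨fun h p q hpq => ?_, fun h p q hpq => ?_⟩
  · rcases List.append_eq_append_iff.1 hpq with ⟨a, rfl, rfl⟩ | ⟨a, rfl, rfl⟩
    · have := h (x ++ u ++ a) q (by simp)
      simpa [h0] using this
    · exact h p (a ++ u ++ y) (by simp)
  · rw [List.append_assoc] at hpq
    rcases List.append_eq_append_iff.1 hpq with ⟨a, rfl, h'⟩ | ⟨a, rfl, rfl⟩
    · rcases List.append_eq_append_iff.1 h' with ⟨b, rfl, rfl⟩ | ⟨b, rfl, rfl⟩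
      · have := h (x ++ b) q (by simp)
        simpa [h0] using this
      · have h1 := h x (y) rfl
        have h2 := hu.2 a b rfl
        simp only [height_append]
        omega
    · exact h p (a ++ y) (by simp)

/-- A prefix `v` of a balanced word that is also a suffix of a balanced word is balanced: its height
is nonnegative for the first reason and nonpositive for the second one. -/
lemma IsBalanced.of_overlap {v v' x : List Bool} (h : IsBalanced (v ++ v'))
    (h' : IsBalanced (x ++ v)) : IsBalanced v := by
  refine ⟨?_, fun p q hpq => h.2 p (q ++ v') (by simp [hpq])⟩
  have h1 := h.2 v v' rfl
  have h2 := h'.2 x v rfl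
  have h3 := h'.1
  simp only [height_append] at h3
  omega

lemma isBalanced_pair : IsBalanced [true, false] := by
  refine ⟨by simp [stepSign], fun p q h => ?_⟩
  rcases p with _ | ⟨a, _ | ⟨b, _ | ⟨c, p⟩⟩⟩ <;> simp_all [stepSign]

lemma exists_true_false {l : List Bool} (h : false ∈ true :: l) :
    ∃ x y, true :: l = x ++ [true, false] ++ y := by
  induction l with
  | nil => simp at h
  | cons b l ih =>
    cases b with
    | false => exact ⟨[], l, rfl⟩
    | true =>
      obtain ⟨x, y, hxy⟩ := ih (by simpa using h)
      exact ⟨true :: x, y, by rw [hxy]; rfl⟩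

/-- A nonempty balanced word has an opening bracket that is directly followed by a closing one. -/
lemma IsBalanced.exists_peak {l : List Bool} (h : IsBalanced l) (hl : l ≠ []) :
    ∃ x y, l = x ++ [true, false] ++ y := by
  obtain ⟨b, l, rfl⟩ := List.exists_cons_of_ne_nil hl
  cases b with
  | false => have := h.2 [false] l rfl; simp [stepSign] at this
  | true =>
    refine exists_true_false ?_
    by_contra hf
    have key : ∀ l : List Bool, false ∉ l → 0 ≤ height l := by
      intro l
      induction l with
      | nil => simp
      | cons b l ih => cases b <;> simp [stepSign]; intro hh; have := ih hh; omega
    have h1 := key l (fun h' => hf (by simp [h']))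
    have h2 := h.1
    simp [stepSign] at h2
    omega

/-! ### Non-crossing pairings and balanced words -/

/-- The bracket word of a pairing: the left end of every arch is an opening bracket and the right
end a closing one. -/
def arcWord {m : ℕ} (σ : Equiv.Perm (Fin m)) : List Bool := List.ofFn fun i => decide (i < σ i)

@[simp] lemma length_arcWord {m : ℕ} (σ : Equiv.Perm (Fin m)) : (arcWord σ).length = m := by
  simp [arcWord]

lemma height_take_arcWord {m : ℕ} (σ : Equiv.Perm (Fin m)) (k : ℕ) :
    height ((arcWord σ).take k) =
      ∑ i : Fin m with i.val < k, stepSign (decide (i < σ i)) := by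
  rw [height, List.map_take, arcWord, List.map_ofFn, List.sum_take_ofFn]
  rfl

/-- The heights of a bracket word over an interval that the pairing maps to itself. -/
lemma height_take_closed {m : ℕ} {σ : Equiv.Perm (Fin m)} (h1 : ∀ i, σ (σ i) = i)
    (h2 : ∀ i, σ i ≠ i) {a b p : ℕ} (hap : a ≤ p) (hpb : p ≤ b)
    (hc : ∀ i : Fin m, a ≤ i.val → i.val < b → a ≤ (σ i).val ∧ (σ i).val < b) :
    height ((arcWord σ).take a) ≤ height ((arcWord σ).take p) ∧
      (p = b → height ((arcWord σ).take p) = height ((arcWord σ).take a)) := by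
  have hε : ∀ i, stepSign (decide (i < σ i)) + stepSign (decide (σ i < σ (σ i))) = 0 := by
    intro i
    rw [h1]
    rcases lt_or_gt_of_ne (h2 i) with h | h <;> simp [stepSign, h, not_lt.2 h.le]
  have hsplit : height ((arcWord σ).take p) = height ((arcWord σ).take a) +
      ∑ i : Fin m with a ≤ i.val ∧ i.val < p, stepSign (decide (i < σ i)) := by
    rw [height_take_arcWord, height_take_arcWord, ← Finset.sum_union]
    · congr 1
      ext i
      simp only [Finset.mem_filter, Finset.mem_univ, true_and, Finset.mem_union]
      omega
    · rw [Finset.disjoint_left]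
      intro i
      simp only [Finset.mem_filter, Finset.mem_univ, true_and]
      omega
  -- The arches with both ends in `[a, p)` cancel; all other points of `[a, p)` are left ends.
  have hinner : ∑ i : Fin m with (a ≤ i.val ∧ i.val < p) ∧ (σ i).val < p,
      stepSign (decide (i < σ i)) = 0 := by
    refine Finset.sum_involution (fun i _ => σ i) (fun i _ => hε i) (fun i _ _ => h2 i) ?_
      (fun i _ => h1 i)
    intro i hi
    simp only [Finset.mem_filter, Finset.mem_univ, true_and] at hi ⊢
    rw [h1]
    have := hc i hi.1.1 (by omega)
    omega
  have houter : ∀ i ∈ Finset.univ.filter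
      (fun i : Fin m => (a ≤ i.val ∧ i.val < p) ∧ ¬ (σ i).val < p),
      stepSign (decide (i < σ i)) = 1 := by
    intro i hi
    simp only [Finset.mem_filter, Finset.mem_univ, true_and] at hi
    have : i < σ i := by rw [Fin.lt_def]; omega
    simp [stepSign, this]
  have hsum := Finset.sum_filter_add_sum_filter_not
    (Finset.univ.filter fun i : Fin m => a ≤ i.val ∧ i.val < p)
    (fun i => (σ i).val < p) (fun i => stepSign (decide (i < σ i)))
  rw [Finset.filter_filter, Finset.filter_filter, hinner, Finset.sum_congr rfl houter] at hsum
  rw [hsplit, ← hsum]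
  refine ⟨by simp, ?_⟩
  rintro rfl
  rw [Finset.filter_false_of_mem]
  · simp
  · intro i _ hi
    have := hc i hi.1.1 hi.1.2
    omega

/-- The factor of a bracket word over an interval that the pairing maps to itself is balanced. -/
lemma isBalanced_of_closed {m : ℕ} {σ : Equiv.Perm (Fin m)} (h1 : ∀ i, σ (σ i) = i)
    (h2 : ∀ i, σ i ≠ i) {x v y : List Bool} (hw : arcWord σ = x ++ v ++ y)
    (hc : ∀ i : Fin m, x.length ≤ i.val → i.val < x.length + v.length →
      x.length ≤ (σ i).val ∧ (σ i).val < x.length + v.length) : IsBalanced v := by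
  have hx : (arcWord σ).take x.length = x := by rw [hw]; simp
  have key : ∀ p q, v = p ++ q → (arcWord σ).take (x.length + p.length) = x ++ p := by
    rintro p q rfl
    rw [hw, List.append_assoc, List.take_length_add_append]
    simp
  refine ⟨?_, fun p q hpq => ?_⟩
  · have := (height_take_closed h1 h2 (Nat.le_add_right _ _) le_rfl hc).2 rfl
    rw [hx, key v [] (by simp)] at this
    simpa using this
  · have hle : p.length ≤ v.length := by simp [hpq]
    have := (height_take_closed h1 h2 (Nat.le_add_right _ p.length) (by omega) hc).1
    rw [hx, key p q hpq] at this
    simpa using this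

lemma IsNonCrossingPairing.isBalanced {m : ℕ} {σ : Equiv.Perm (Fin m)}
    (h : IsNonCrossingPairing σ) : IsBalanced (arcWord σ) :=
  isBalanced_of_closed (x := []) (y := []) h.1 h.2.1 (by simp) fun i _ _ => by simp

/-- The points strictly below an arch are matched among themselves. -/
lemma IsNonCrossingPairing.interior_closed {m : ℕ} {σ : Equiv.Perm (Fin m)}
    (h : IsNonCrossingPairing σ) {i k : Fin m} (hik : i < k) (hk : k < σ i) :
    i < σ k ∧ σ k < σ i := by
  have h1 := h.2.2 i k
  have hki : σ k ≠ i := fun e => by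
    have := h.1 k
    rw [e] at this
    exact hk.ne this.symm
  have hks : σ k ≠ σ i := fun e => hik.ne (σ.injective e).symm
  constructor
  · by_contra hlt
    have hlt' : σ k < i := lt_of_le_of_ne (not_lt.1 hlt) hki
    exact h.2.2 (σ k) i ⟨hlt', by rwa [h.1], by rwa [h.1]⟩
  · by_contra hlt
    exact h1 ⟨hik, hk, lt_of_le_of_ne (not_lt.1 hlt) hks.symm⟩

/-- A non-crossing pairing is determined by its bracket word. -/
lemma arcWord_injective {m : ℕ} {σ τ : Equiv.Perm (Fin m)} (hσ : IsNonCrossingPairing σ)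
    (hτ : IsNonCrossingPairing τ) (h : arcWord σ = arcWord τ) : σ = τ := by
  have hl : ∀ i, i < σ i ↔ i < τ i := fun i => by
    have := congrFun (List.ofFn_injective h) i
    simpa using this
  -- If the arch of `τ` that starts in `i` were longer than that of `σ`, then the word would fall
  -- below its height after `i` at the right end of the arch of `σ`.
  have key : ∀ {σ τ : Equiv.Perm (Fin m)}, IsNonCrossingPairing σ → IsNonCrossingPairing τ →
      arcWord σ = arcWord τ → ∀ i, i < σ i → i < τ i → τ i ≤ σ i := by
    intro σ τ hσ hτ h i hi hi'
    by_contra hlt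
    rw [not_le] at hlt
    have e1 := (height_take_closed (a := i.val + 1) (b := (σ i).val) hσ.1 hσ.2.1
      (Fin.lt_def.1 hi) le_rfl fun k hk hk' => by
        have := hσ.interior_closed (i := i) (k := k) (by rw [Fin.lt_def]; omega)
          (by rw [Fin.lt_def]; omega)
        simp only [Fin.lt_def] at this
        omega).2 rfl
    have e2 := (height_take_closed (a := i.val + 1) (b := (τ i).val) (p := (σ i).val + 1) hτ.1
      hτ.2.1 (by rw [Fin.lt_def] at hi; omega) (Fin.lt_def.1 hlt) fun k hk hk' => by
        have := hτ.interior_closed (i := i) (k := k) (by rw [Fin.lt_def]; omega)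
          (by rw [Fin.lt_def]; omega)
        simp only [Fin.lt_def] at this
        omega).1
    have e3 : height ((arcWord σ).take ((σ i).val + 1)) =
        height ((arcWord σ).take (σ i).val) - 1 := by
      rw [List.take_add_one]
      have : (arcWord σ)[(σ i).val]? = some false := by
        rw [List.getElem?_eq_getElem (by simp)]
        simp [arcWord, hσ.1, hi.le]
      rw [this]
      simp [stepSign]
      rfl
    rw [← h] at e2
    omega
  have main : ∀ i, i < σ i → τ i = σ i := fun i hi =>
    le_antisymm (key hσ hτ h i hi ((hl i).1 hi)) (key hτ hσ h.symm i ((hl i).1 hi) hi)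
  ext1 i
  rcases lt_or_gt_of_ne (hσ.2.1 i) with hi | hi
  · have := main (σ i) (by rwa [hσ.1])
    rw [hσ.1] at this
    rw [← this, hτ.1, this]
  · exact (main i hi).symm

/-! ### Inserting one system into a gap of another -/

/-- The positions of the letters of `x` and `y` in `x ++ u ++ y`, where `a`, `c`, `b` are the
lengths of `x`, `u`, `y`. -/
def outerPos (a c b : ℕ) (i : Fin (a + b)) : Fin (a + c + b) :=
  if h : i.val < a then ⟨i.val, by omega⟩ else ⟨i.val + c, by omega⟩

/-- The positions of the letters of `u` in `x ++ u ++ y`, where `a`, `c`, `b` are the lengths of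
`x`, `u`, `y`. -/
def innerPos (a c b : ℕ) (i : Fin c) : Fin (a + c + b) := ⟨a + i.val, by omega⟩

lemma outerPos_val (a c b : ℕ) (i : Fin (a + b)) :
    (outerPos a c b i).val = if i.val < a then i.val else i.val + c := by
  unfold outerPos; split <;> rfl

@[simp] lemma innerPos_val (a c b : ℕ) (i : Fin c) : (innerPos a c b i).val = a + i.val := rfl

lemma outerPos_lt_iff {a c b : ℕ} {i j : Fin (a + b)} :
    outerPos a c b i < outerPos a c b j ↔ i < j := by
  rw [Fin.lt_def, Fin.lt_def, outerPos_val, outerPos_val]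
  split_ifs <;> omega

lemma innerPos_lt_iff {a c b : ℕ} {i j : Fin c} :
    innerPos a c b i < innerPos a c b j ↔ i < j := by
  rw [Fin.lt_def, Fin.lt_def, innerPos_val, innerPos_val]
  omega

lemma outerPos_lt_innerPos {a c b : ℕ} {i : Fin (a + b)} {j : Fin c} :
    outerPos a c b i < innerPos a c b j ↔ i.val < a := by
  rw [Fin.lt_def, outerPos_val, innerPos_val]
  split_ifs <;> omega

lemma innerPos_lt_outerPos {a c b : ℕ} {i : Fin (a + b)} {j : Fin c} :
    innerPos a c b j < outerPos a c b i ↔ ¬ i.val < a := by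
  rw [Fin.lt_def, outerPos_val, innerPos_val]
  split_ifs <;> omega

lemma insertPos_bijective (a c b : ℕ) :
    Function.Bijective (Sum.elim (outerPos a c b) (innerPos a c b)) := by
  constructor
  · rintro (i | i) (j | j) h <;>
      simp only [Sum.elim_inl, Sum.elim_inr, Fin.ext_iff, outerPos_val, innerPos_val] at h
    · congr 1; ext; split_ifs at h <;> omega
    · split_ifs at h <;> omega
    · split_ifs at h <;> omega
    · congr 1; ext; omega
  · intro k
    by_cases h1 : k.val < a
    · exact ⟨.inl ⟨k.val, by omega⟩, by simp [Fin.ext_iff, outerPos_val, h1]⟩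
    · by_cases h2 : k.val < a + c
      · exact ⟨.inr ⟨k.val - a, by omega⟩, by simp [Fin.ext_iff]; omega⟩
      · refine ⟨.inl ⟨k.val - c, by omega⟩, ?_⟩
        simp only [Sum.elim_inl, Fin.ext_iff, outerPos_val]
        split_ifs <;> omega

/-- The points of the outer and of the inner system make up the points of the combined one. -/
noncomputable def insertPos (a c b : ℕ) : Fin (a + b) ⊕ Fin c ≃ Fin (a + c + b) :=
  Equiv.ofBijective _ (insertPos_bijective a c b)

@[simp] lemma insertPos_inl (a c b : ℕ) (i : Fin (a + b)) :
    insertPos a c b (.inl i) = outerPos a c b i := rfl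

@[simp] lemma insertPos_inr (a c b : ℕ) (i : Fin c) :
    insertPos a c b (.inr i) = innerPos a c b i := rfl

/-- The pairing `τ` inserted into the gap of the pairing `σ` before its point `a`. -/
noncomputable def insertPairing {a c b : ℕ} (σ : Equiv.Perm (Fin (a + b)))
    (τ : Equiv.Perm (Fin c)) : Equiv.Perm (Fin (a + c + b)) :=
  (insertPos a c b).permCongr (Equiv.sumCongr σ τ)

@[simp] lemma insertPairing_outerPos {a c b : ℕ} (σ : Equiv.Perm (Fin (a + b)))
    (τ : Equiv.Perm (Fin c)) (i : Fin (a + b)) :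
    insertPairing σ τ (outerPos a c b i) = outerPos a c b (σ i) := by
  rw [← insertPos_inl, insertPairing, Equiv.permCongr_apply, Equiv.symm_apply_apply]
  simp

@[simp] lemma insertPairing_innerPos {a c b : ℕ} (σ : Equiv.Perm (Fin (a + b)))
    (τ : Equiv.Perm (Fin c)) (i : Fin c) :
    insertPairing σ τ (innerPos a c b i) = innerPos a c b (τ i) := by
  rw [← insertPos_inr, insertPairing, Equiv.permCongr_apply, Equiv.symm_apply_apply]
  simp

lemma forall_insertPos {a c b : ℕ} {p : Fin (a + c + b) → Prop} :
    (∀ k, p k) ↔ (∀ i, p (outerPos a c b i)) ∧ ∀ i, p (innerPos a c b i) := by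
  refine ⟨fun h => ⟨fun i => h _, fun i => h _⟩, fun h k => ?_⟩
  obtain ⟨i | i, rfl⟩ := (insertPos a c b).surjective k
  · exact h.1 i
  · exact h.2 i

lemma isNonCrossingPairing_insertPairing {a c b : ℕ} {σ : Equiv.Perm (Fin (a + b))}
    {τ : Equiv.Perm (Fin c)} (hσ : IsNonCrossingPairing σ) (hτ : IsNonCrossingPairing τ) :
    IsNonCrossingPairing (insertPairing σ τ) := by
  refine ⟨?_, ?_, ?_⟩
  · rw [forall_insertPos]
    simp [hσ.1, hτ.1]
  · rw [forall_insertPos]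
    refine ⟨fun i h => ?_, fun i h => ?_⟩
    · rw [insertPairing_outerPos, ← insertPos_inl, ← insertPos_inl,
        (insertPos a c b).apply_eq_iff_eq, Sum.inl.injEq] at h
      exact hσ.2.1 i h
    · rw [insertPairing_innerPos, ← insertPos_inr, ← insertPos_inr,
        (insertPos a c b).apply_eq_iff_eq, Sum.inr.injEq] at h
      exact hτ.2.1 i h
  · simp only [forall_insertPos, insertPairing_outerPos, insertPairing_innerPos, outerPos_lt_iff,
      innerPos_lt_iff, outerPos_lt_innerPos, innerPos_lt_outerPos]
    refine ⟨fun i => ⟨hσ.2.2 i, fun j => ?_⟩, fun i => ⟨fun j => ?_, hτ.2.2 i⟩⟩ <;> tauto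

/-- The word of arches of a pair of pairings, an upper and a lower one. -/
def pairWord {m : ℕ} (σ τ : Equiv.Perm (Fin m)) : List (Bool × Bool) :=
  List.ofFn fun i => (decide (i < σ i), decide (i < τ i))

@[simp] lemma length_pairWord {m : ℕ} (σ τ : Equiv.Perm (Fin m)) : (pairWord σ τ).length = m := by
  simp [pairWord]

@[simp] lemma map_fst_pairWord {m : ℕ} (σ τ : Equiv.Perm (Fin m)) :
    (pairWord σ τ).map Prod.fst = arcWord σ := by
  rw [pairWord, List.map_ofFn]; rfl

@[simp] lemma map_snd_pairWord {m : ℕ} (σ τ : Equiv.Perm (Fin m)) :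
    (pairWord σ τ).map Prod.snd = arcWord τ := by
  rw [pairWord, List.map_ofFn]; rfl

lemma arcWord_insertPairing {x u y : List Bool}
    {σ : Equiv.Perm (Fin (x.length + y.length))} {τ : Equiv.Perm (Fin u.length)}
    (hσ : arcWord σ = x ++ y) (hτ : arcWord τ = u) :
    arcWord (insertPairing σ τ) = x ++ u ++ y := by
  have hσ' : ∀ i, decide (i < σ i) = (x ++ y)[i.val]'(by simp) := by
    intro i
    have : (arcWord σ)[i.val]'(by simp) = decide (i < σ i) := by simp [arcWord]
    rw [← this]
    simp only [hσ]
  have hτ' : ∀ i, decide (i < τ i) = u[i.val] := by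
    intro i
    have : (arcWord τ)[i.val]'(by simp) = decide (i < τ i) := by simp [arcWord]
    rw [← this]
    simp only [hτ]
  have key : ∀ k : Fin (x.length + u.length + y.length),
      decide (k < insertPairing σ τ k) = (x ++ u ++ y)[k.val]'(by simp; omega) := by
    rw [forall_insertPos]
    refine ⟨fun i => ?_, fun i => ?_⟩
    · simp only [insertPairing_outerPos, outerPos_lt_iff, hσ', outerPos_val, List.getElem_append,
        List.length_append]
      split_ifs <;> first | rfl | omega | (congr 1; omega)
    · simp only [insertPairing_innerPos, innerPos_lt_iff, hτ', innerPos_val, List.getElem_append,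
        List.length_append]
      split_ifs <;> first | rfl | omega | (congr 1; omega)
  refine List.ext_getElem (by simp [add_assoc]) fun k hk hk' => ?_
  have := key ⟨k, by simpa using hk⟩
  simpa [arcWord] using this

/-- Every balanced word is the word of a non-crossing pairing. -/
lemma IsBalanced.exists_pairing {w : List Bool} (hw : IsBalanced w) {m : ℕ} (hm : w.length = m) :
    ∃ σ : Equiv.Perm (Fin m), IsNonCrossingPairing σ ∧ arcWord σ = w := by
  induction m using Nat.strong_induction_on generalizing w with
  | _ m ih =>
    by_cases h0 : w = []
    · subst h0
      subst hm
      exact ⟨1, ⟨fun i => rfl, fun i => i.elim0, fun i => i.elim0⟩, rfl⟩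
    · obtain ⟨x, y, rfl⟩ := hw.exists_peak h0
      obtain rfl : x.length + [true, false].length + y.length = m := by
        rw [← hm]; simp only [List.length_append]
      have hxy := (isBalanced_insert_iff isBalanced_pair x y).1 hw
      obtain ⟨σ, hσ, hσ'⟩ := ih (x.length + y.length) (by simp) hxy (by simp)
      have hτ : IsNonCrossingPairing (Equiv.swap 0 1 : Equiv.Perm (Fin 2)) := by
        unfold IsNonCrossingPairing; decide
      exact ⟨insertPairing σ (c := 2) (Equiv.swap 0 1), isNonCrossingPairing_insertPairing hσ hτ,
        arcWord_insertPairing (u := [true, false]) hσ' (by decide)⟩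

/-! ### Loops -/

/-- The graph of arches of a pair of pairings. -/
def arcGraph {m : ℕ} (σ τ : Equiv.Perm (Fin m)) : SimpleGraph (Fin m) :=
  SimpleGraph.fromRel fun i j => σ i = j ∨ τ i = j

/-- The number of loops of a pair of pairings. -/
noncomputable def loopNumber {m : ℕ} (σ τ : Equiv.Perm (Fin m)) : ℕ :=
  Nat.card (arcGraph σ τ).ConnectedComponent

lemma card_connectedComponent_sum {V W : Type*} [Finite V] [Finite W] (G : SimpleGraph V)
    (H : SimpleGraph W) : Nat.card (G ⊕g H).ConnectedComponent =
      Nat.card G.ConnectedComponent + Nat.card H.ConnectedComponent := by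
  rw [← Nat.card_sum]
  have hadj : ∀ {v w : V ⊕ W}, (G ⊕g H).Walk v w →
      Sum.map G.connectedComponentMk H.connectedComponentMk v =
        Sum.map G.connectedComponentMk H.connectedComponentMk w := by
    intro v w p
    induction p with
    | nil => rfl
    | @cons u v w h p ih =>
      rw [← ih]
      rcases u with u | u <;> rcases v with v | v
      · exact congrArg Sum.inl
          (SimpleGraph.ConnectedComponent.connectedComponentMk_eq_of_adj (by simpa using h))
      · simp at h
      · simp at h
      · exact congrArg Sum.inr
          (SimpleGraph.ConnectedComponent.connectedComponentMk_eq_of_adj (by simpa using h))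
  refine Nat.card_congr
    { toFun := SimpleGraph.ConnectedComponent.lift
        (Sum.map G.connectedComponentMk H.connectedComponentMk) fun v w p _ => hadj p
      invFun := Sum.elim
        (SimpleGraph.ConnectedComponent.map SimpleGraph.Embedding.sumInl.toHom)
        (SimpleGraph.ConnectedComponent.map SimpleGraph.Embedding.sumInr.toHom)
      left_inv := ?_
      right_inv := ?_ }
  · refine SimpleGraph.ConnectedComponent.ind ?_
    rintro (v | v) <;> rfl
  · rintro (c | c) <;> induction c using SimpleGraph.ConnectedComponent.ind <;> rfl

/-- Inserting a system into a gap of another one adds up the numbers of loops. -/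
lemma loopNumber_insertPairing {a c b : ℕ} (σ σ' : Equiv.Perm (Fin (a + b)))
    (τ τ' : Equiv.Perm (Fin c)) :
    loopNumber (insertPairing σ τ) (insertPairing σ' τ') =
      loopNumber σ σ' + loopNumber τ τ' := by
  rw [loopNumber, loopNumber, loopNumber, ← card_connectedComponent_sum]
  refine Nat.card_congr (SimpleGraph.Iso.connectedComponentEquiv (SimpleGraph.Iso.symm
    ⟨insertPos a c b, ?_⟩))
  have h1 : ∀ i j, outerPos a c b i = outerPos a c b j ↔ i = j := fun i j => by
    rw [← insertPos_inl, ← insertPos_inl, (insertPos a c b).apply_eq_iff_eq, Sum.inl.injEq]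
  have h2 : ∀ i j, innerPos a c b i = innerPos a c b j ↔ i = j := fun i j => by
    rw [← insertPos_inr, ← insertPos_inr, (insertPos a c b).apply_eq_iff_eq, Sum.inr.injEq]
  have h3 : ∀ i j, outerPos a c b i ≠ innerPos a c b j := fun i j => by
    rw [← insertPos_inl, ← insertPos_inr, (insertPos a c b).apply_eq_iff_eq.ne]
    simp
  have h4 : ∀ i j, innerPos a c b i ≠ outerPos a c b j := fun i j => (h3 j i).symm
  rintro (i | i) (j | j) <;> simp [arcGraph, h1, h2, h3, h4]

/-! ### Words of meandric systems -/

/-- The words of meandric systems: lists of pairs of brackets, those above and those below the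
line, such that both bracket words are balanced. -/
def IsSystemWord (w : List (Bool × Bool)) : Prop :=
  IsBalanced (w.map Prod.fst) ∧ IsBalanced (w.map Prod.snd)

lemma isSystemWord_nil : IsSystemWord [] := ⟨isBalanced_nil, isBalanced_nil⟩

lemma isSystemWord_insert_iff {u : List (Bool × Bool)} (hu : IsSystemWord u)
    (x y : List (Bool × Bool)) : IsSystemWord (x ++ u ++ y) ↔ IsSystemWord (x ++ y) := by
  simp only [IsSystemWord, List.map_append, isBalanced_insert_iff hu.1, isBalanced_insert_iff hu.2]

lemma IsSystemWord.append {u v : List (Bool × Bool)} (hu : IsSystemWord u) (hv : IsSystemWord v) :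
    IsSystemWord (u ++ v) := by
  simpa using (isSystemWord_insert_iff hv u []).2 (by simpa using hu)

lemma IsSystemWord.of_append_left {u v : List (Bool × Bool)} (hu : IsSystemWord u)
    (h : IsSystemWord (u ++ v)) : IsSystemWord v := by
  simpa using (isSystemWord_insert_iff hu [] v).1 h

lemma IsSystemWord.of_append_right {u v : List (Bool × Bool)} (hv : IsSystemWord v)
    (h : IsSystemWord (u ++ v)) : IsSystemWord u := by
  simpa using (isSystemWord_insert_iff hv u []).1 (by simpa using h)

lemma IsSystemWord.of_overlap {v v' x : List (Bool × Bool)} (h : IsSystemWord (v ++ v'))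
    (h' : IsSystemWord (x ++ v)) : IsSystemWord v := by
  simp only [IsSystemWord, List.map_append] at h h'
  exact ⟨h.1.of_overlap h'.1, h.2.of_overlap h'.2⟩

lemma pairWord_eq_iff {m : ℕ} {σ τ : Equiv.Perm (Fin m)} {w : List (Bool × Bool)} :
    pairWord σ τ = w ↔ arcWord σ = w.map Prod.fst ∧ arcWord τ = w.map Prod.snd := by
  constructor
  · rintro rfl
    simp
  · rintro ⟨h1, h2⟩
    rw [← map_fst_pairWord σ τ] at h1
    rw [← map_snd_pairWord σ τ] at h2
    have key : ∀ l : List (Bool × Bool), List.zip (l.map Prod.fst) (l.map Prod.snd) = l := by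
      intro l
      induction l with
      | nil => rfl
      | cons a l ih => simp [ih]
    rw [← key (pairWord σ τ), h1, h2, key]

lemma isSystemWord_pairWord {m : ℕ} {σ τ : Equiv.Perm (Fin m)} (hσ : IsNonCrossingPairing σ)
    (hτ : IsNonCrossingPairing τ) : IsSystemWord (pairWord σ τ) := by
  simpa [IsSystemWord] using ⟨hσ.isBalanced, hτ.isBalanced⟩

lemma IsSystemWord.exists_pairings {w : List (Bool × Bool)} (hw : IsSystemWord w) {m : ℕ}
    (hm : w.length = m) : ∃ σ τ : Equiv.Perm (Fin m), IsNonCrossingPairing σ ∧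
      IsNonCrossingPairing τ ∧ pairWord σ τ = w := by
  obtain ⟨σ, hσ, h1⟩ := hw.1.exists_pairing (m := m) (by simpa using hm)
  obtain ⟨τ, hτ, h2⟩ := hw.2.exists_pairing (m := m) (by simpa using hm)
  exact ⟨σ, τ, hσ, hτ, pairWord_eq_iff.2 ⟨h1, h2⟩⟩

lemma pairWord_injective {m : ℕ} {σ τ σ' τ' : Equiv.Perm (Fin m)} (hσ : IsNonCrossingPairing σ)
    (hτ : IsNonCrossingPairing τ) (hσ' : IsNonCrossingPairing σ') (hτ' : IsNonCrossingPairing τ')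
    (h : pairWord σ τ = pairWord σ' τ') : σ = σ' ∧ τ = τ' := by
  rw [pairWord_eq_iff] at h
  simp only [map_fst_pairWord, map_snd_pairWord] at h
  exact ⟨arcWord_injective hσ hσ' h.1, arcWord_injective hτ hτ' h.2⟩

/-- The number of loops of the meandric system with the given word. A system word belongs to exactly
one pair of pairings, so that the infimum is over a single number. -/
noncomputable def wordLoops (w : List (Bool × Bool)) : ℕ :=
  sInf {k | ∃ (m : ℕ) (σ τ : Equiv.Perm (Fin m)), IsNonCrossingPairing σ ∧
    IsNonCrossingPairing τ ∧ pairWord σ τ = w ∧ loopNumber σ τ = k}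

lemma wordLoops_pairWord {m : ℕ} {σ τ : Equiv.Perm (Fin m)} (hσ : IsNonCrossingPairing σ)
    (hτ : IsNonCrossingPairing τ) : wordLoops (pairWord σ τ) = loopNumber σ τ := by
  have hset : {k | ∃ (m' : ℕ) (σ' τ' : Equiv.Perm (Fin m')), IsNonCrossingPairing σ' ∧
      IsNonCrossingPairing τ' ∧ pairWord σ' τ' = pairWord σ τ ∧ loopNumber σ' τ' = k} =
      {loopNumber σ τ} := by
    ext k
    constructor
    · rintro ⟨m', σ', τ', hσ', hτ', h, rfl⟩
      obtain rfl : m' = m := by simpa using congrArg List.length h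
      obtain ⟨rfl, rfl⟩ := pairWord_injective hσ' hτ' hσ hτ h
      rfl
    · rintro rfl
      exact ⟨m, σ, τ, hσ, hτ, rfl, rfl⟩
  rw [wordLoops, hset, csInf_singleton]

lemma wordLoops_insert {x u y : List (Bool × Bool)} (hxy : IsSystemWord (x ++ y))
    (hu : IsSystemWord u) : wordLoops (x ++ u ++ y) = wordLoops (x ++ y) + wordLoops u := by
  obtain ⟨σ, σ', hσ, hσ', h⟩ := hxy.exists_pairings (m := (x.map Prod.fst).length +
    (y.map Prod.fst).length) (by simp)
  obtain ⟨τ, τ', hτ, hτ', h'⟩ := hu.exists_pairings (m := (u.map Prod.fst).length) (by simp)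
  have hw : pairWord (insertPairing σ τ) (insertPairing σ' τ') = x ++ u ++ y := by
    rw [pairWord_eq_iff] at h h' ⊢
    simp only [List.map_append] at h h' ⊢
    refine ⟨arcWord_insertPairing h.1 h'.1, ?_⟩
    have e : ∀ l : List (Bool × Bool), (l.map Prod.fst).length = (l.map Prod.snd).length := by simp
    have key : ∀ {a b c : ℕ} (σ : Equiv.Perm (Fin (a + b))) (τ : Equiv.Perm (Fin c))
        {x u y : List Bool}, a = x.length → b = y.length → c = u.length → arcWord σ = x ++ y →
        arcWord τ = u → arcWord (insertPairing σ τ) = x ++ u ++ y := by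
      rintro a b c σ τ x u y rfl rfl rfl h h'
      exact arcWord_insertPairing h h'
    exact key σ' τ' (e x) (e y) (e u) h.2 h'.2
  have e1 := wordLoops_pairWord hσ hσ'
  have e2 := wordLoops_pairWord hτ hτ'
  have e3 := wordLoops_pairWord (isNonCrossingPairing_insertPairing hσ hτ)
    (isNonCrossingPairing_insertPairing hσ' hτ')
  rw [h] at e1
  rw [h'] at e2
  rw [hw] at e3
  rw [e1, e2, e3, loopNumber_insertPairing]

/-! ### Bounds for the number of loops -/

/-- If every loop has at least `d` points, then there are at most `m / d` loops. -/
lemma mul_loopNumber_le {m d : ℕ} (σ τ : Equiv.Perm (Fin m))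
    (h : ∀ i, ∃ s : Finset (Fin m), d ≤ s.card ∧ ∀ j ∈ s, (arcGraph σ τ).Reachable j i) :
    d * loopNumber σ τ ≤ m := by
  classical
  have : Fintype (arcGraph σ τ).ConnectedComponent := Fintype.ofFinite _
  have := Finset.mul_card_image_le_card_of_maps_to (s := (Finset.univ : Finset (Fin m)))
    (t := (Finset.univ : Finset (arcGraph σ τ).ConnectedComponent))
    (f := (arcGraph σ τ).connectedComponentMk) (by simp) d (fun c _ => by
      induction c using SimpleGraph.ConnectedComponent.ind with
      | _ i =>
        obtain ⟨s, hs, hs'⟩ := h i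
        refine hs.trans (Finset.card_le_card fun j hj => ?_)
        simpa using hs' j hj)
  simpa [loopNumber, Nat.card_eq_fintype_card] using this

lemma reachable_upper {m : ℕ} (σ τ : Equiv.Perm (Fin m)) (i : Fin m) :
    (arcGraph σ τ).Reachable (σ i) i := by
  by_cases h : σ i = i
  · rw [h]
  · exact SimpleGraph.Adj.reachable (by simp [arcGraph, h])

lemma reachable_lower {m : ℕ} (σ τ : Equiv.Perm (Fin m)) (i : Fin m) :
    (arcGraph σ τ).Reachable (τ i) i := by
  by_cases h : τ i = i
  · rw [h]
  · exact SimpleGraph.Adj.reachable (by simp [arcGraph, h])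

lemma IsSystemWord.two_mul_wordLoops_le {w : List (Bool × Bool)} (hw : IsSystemWord w) :
    2 * wordLoops w ≤ w.length := by
  obtain ⟨σ, τ, hσ, hτ, h⟩ := hw.exists_pairings rfl
  conv_lhs => rw [← h]
  rw [wordLoops_pairWord hσ hτ]
  refine mul_loopNumber_le σ τ fun i => ⟨{σ i, i}, by rw [Finset.card_pair (hσ.2.1 i)], ?_⟩
  intro j hj
  rw [Finset.mem_insert, Finset.mem_singleton] at hj
  rcases hj with rfl | rfl
  · exact reachable_upper σ τ i
  · exact .rfl

lemma IsSystemWord.wordLoops_pos {w : List (Bool × Bool)} (hw : IsSystemWord w) (h0 : w ≠ []) :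
    0 < wordLoops w := by
  obtain ⟨σ, τ, hσ, hτ, h⟩ := hw.exists_pairings rfl
  have : Nonempty (Fin w.length) := ⟨⟨0, List.length_pos_iff.2 h0⟩⟩
  rw [← h, wordLoops_pairWord hσ hτ]
  have : Nonempty (arcGraph σ τ).ConnectedComponent := this.map (arcGraph σ τ).connectedComponentMk
  exact Nat.card_pos

lemma IsBalanced.even_length {l : List Bool} (h : IsBalanced l) : Even l.length := by
  have key : ∀ l : List Bool, Even (height l + l.length) := by
    intro l
    induction l with
    | nil => simp
    | cons b l ih =>
      obtain ⟨k, hk⟩ := ih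
      cases b <;> simp only [height_cons, stepSign, List.length_cons, Nat.cast_add]
      · exact ⟨k, by simp; omega⟩
      · exact ⟨k + 1, by simp; omega⟩
  have := key l
  rw [h.1, zero_add] at this
  exact_mod_cast this

lemma IsSystemWord.even_length {w : List (Bool × Bool)} (hw : IsSystemWord w) : Even w.length := by
  simpa using hw.1.even_length

/-- A system word is irreducible when it is not empty and contains no other nonempty system
word as a factor, that is, when no proper interval of points is a union of loops. -/
def IsIrreducibleWord (k : List (Bool × Bool)) : Prop :=
  IsSystemWord k ∧ k ≠ [] ∧ ∀ x u y, k = x ++ u ++ y → IsSystemWord u → u = [] ∨ u = k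

/-- The word of the system of a single loop through two points. -/
def circleWord : List (Bool × Bool) := [(true, true), (false, false)]

lemma isSystemWord_factor_of_closed {m : ℕ} {σ τ : Equiv.Perm (Fin m)}
    (hσ : IsNonCrossingPairing σ) (hτ : IsNonCrossingPairing τ) {p q : ℕ} (hpq : p ≤ q)
    (hqm : q ≤ m) (hc : ∀ i : Fin m, p ≤ i.val → i.val < q →
      (p ≤ (σ i).val ∧ (σ i).val < q) ∧ p ≤ (τ i).val ∧ (τ i).val < q) :
    IsSystemWord (((pairWord σ τ).drop p).take (q - p)) := by
  have hsplit : ∀ {α : Type} (l : List α), l = l.take p ++ (l.drop p).take (q - p) ++ l.drop q := by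
    intro α l
    conv_lhs => rw [← List.take_append_drop p l, ← List.take_append_drop (q - p) (l.drop p)]
    rw [List.drop_drop, List.append_assoc]
    congr 3
    omega
  have hlen : ∀ l : List Bool, l.length = m → (l.take p).length = p ∧
      (l.take p).length + ((l.drop p).take (q - p)).length = q := by
    intro l hl
    simp only [List.length_take, List.length_drop, hl]
    omega
  simp only [IsSystemWord, List.map_take, List.map_drop, map_fst_pairWord, map_snd_pairWord]
  refine ⟨isBalanced_of_closed hσ.1 hσ.2.1 (hsplit (arcWord σ)) ?_,
    isBalanced_of_closed hτ.1 hτ.2.1 (hsplit (arcWord τ)) ?_⟩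
  · intro i
    rw [(hlen _ (length_arcWord σ)).2, (hlen _ (length_arcWord σ)).1]
    exact fun h h' => (hc i h h').1
  · intro i
    rw [(hlen _ (length_arcWord τ)).2, (hlen _ (length_arcWord τ)).1]
    exact fun h h' => (hc i h h').2

/-- All loops of an irreducible system other than the circle have at least four points: a loop
through two points would enclose an interval that is a union of loops. -/
lemma IsIrreducibleWord.four_mul_wordLoops_le {k : List (Bool × Bool)} (hk : IsIrreducibleWord k)
    (hne : k ≠ circleWord) : 4 * wordLoops k ≤ k.length := by
  obtain ⟨σ, τ, hσ, hτ, h⟩ := hk.1.exists_pairings rfl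
  have hdis : ∀ i, σ i ≠ τ i := by
    have key : ∀ i, i < σ i → σ i ≠ τ i := by
      intro i hi he
      refine hne ?_
      have hirr : ∀ p q, p ≤ q → q ≤ k.length → (∀ j : Fin k.length, p ≤ j.val → j.val < q →
          (p ≤ (σ j).val ∧ (σ j).val < q) ∧ p ≤ (τ j).val ∧ (τ j).val < q) →
          q = p ∨ q - p = k.length := by
        intro p q hpq hq hc
        have hs := isSystemWord_factor_of_closed hσ hτ hpq hq hc
        rw [h] at hs
        have := hk.2.2 (k.take p) _ (k.drop p |>.drop (q - p)) (by simp) hs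
        have hl : ((k.drop p).take (q - p)).length = q - p := by simp; omega
        rcases this with h0 | h0
        · rw [h0] at hl
          simp at hl
          omega
        · rw [h0] at hl
          exact .inr hl.symm
      have hi' := Fin.lt_def.1 hi
      have hin : ∀ j : Fin k.length, i.val < j.val → j.val < (σ i).val →
          (i.val < (σ j).val ∧ (σ j).val < (σ i).val) ∧
            i.val < (τ j).val ∧ (τ j).val < (σ i).val := by
        intro j h1 h2
        refine ⟨hσ.interior_closed h1 h2, ?_⟩
        have := hτ.interior_closed (i := i) (k := j) h1 (he ▸ h2)
        rwa [← he] at this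
      have h1 := hirr (i.val + 1) (σ i).val hi' (by omega) fun j hj hj' => by
        have := hin j hj hj'
        omega
      have h2 := hirr i.val ((σ i).val + 1) (by omega) (by omega) fun j hj hj' => by
        rcases eq_or_lt_of_le hj with e | e
        · have e' : i = j := Fin.ext e
          subst e'
          rw [← he]
          omega
        · rcases eq_or_lt_of_le (Nat.lt_succ_iff.1 hj') with e2 | e2
          · have e' : j = σ i := Fin.ext e2
            have e3 : τ j = i := by rw [e', he, hτ.1]
            rw [e3, e', hσ.1]
            omega
          · have := hin j e e2
            omega
      have hlen : k.length = 2 := by have := (σ i).isLt; omega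
      obtain ⟨⟨a, a'⟩, ⟨b, b'⟩, rfl⟩ := List.length_eq_two.1 hlen
      have hs := hk.1
      have e1 := hs.1.1
      have e2 := hs.1.2 [a] [b] rfl
      have e3 := hs.2.1
      have e4 := hs.2.2 [a'] [b'] rfl
      clear * - e1 e2 e3 e4
      cases a <;> cases b <;> cases a' <;> cases b' <;> simp_all [stepSign, circleWord]
    intro i
    rcases lt_or_gt_of_ne (hσ.2.1 i) with hi | hi
    · intro he
      refine key (σ i) (by rwa [hσ.1]) ?_
      conv_rhs => rw [he]
      rw [hσ.1, hτ.1]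
    · exact key i hi
  conv_lhs => rw [← h]
  rw [wordLoops_pairWord hσ hτ]
  refine mul_loopNumber_le σ τ fun i => ⟨{σ (τ i), τ i, σ i, i}, ?_, ?_⟩
  · have h1 : σ i ≠ i := hσ.2.1 i
    have h2 : τ i ≠ i := hτ.2.1 i
    have h3 : σ (τ i) ≠ τ i := hσ.2.1 _
    have h4 : σ (τ i) ≠ σ i := fun e => h2 (σ.injective e)
    have h5 : σ (τ i) ≠ i := fun e => hdis i (by rw [← e, hσ.1, e])
    have h6 := (hdis i).symm
    rw [Finset.card_insert_of_notMem (by simp [h3, h4, h5]),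
      Finset.card_insert_of_notMem (by simp [h2, h6]), Finset.card_pair h1]
  · intro j hj
    simp only [Finset.mem_insert, Finset.mem_singleton] at hj
    rcases hj with rfl | rfl | rfl | rfl
    · exact (reachable_upper σ τ _).trans (reachable_lower σ τ i)
    · exact reachable_lower σ τ i
    · exact reachable_upper σ τ i
    · exact .rfl

/-! ### Decomposition of a system into an irreducible system and the systems in its gaps -/

/-- The word `k₁ u₁ k₂ u₂ ⋯` obtained from a list of letters `kᵢ` and system words `uᵢ`. -/
def fill : List ((Bool × Bool) × {w // IsSystemWord w}) → List (Bool × Bool)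
  | [] => []
  | (a, u) :: P => a :: (u.1 ++ fill P)

lemma fill_append (P Q : List ((Bool × Bool) × {w // IsSystemWord w})) :
    fill (P ++ Q) = fill P ++ fill Q := by
  induction P with
  | nil => rfl
  | cons p P ih => simp [fill, ih]

lemma isSystemWord_append_fill_iff (P : List ((Bool × Bool) × {w // IsSystemWord w}))
    (x : List (Bool × Bool)) :
    IsSystemWord (x ++ fill P) ↔ IsSystemWord (x ++ P.map Prod.fst) := by
  induction P generalizing x with
  | nil => rfl
  | cons p P ih =>
    have e1 : x ++ fill (p :: P) = (x ++ [p.1]) ++ p.2.1 ++ fill P := by simp [fill]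
    have e2 : x ++ (p :: P).map Prod.fst = (x ++ [p.1]) ++ P.map Prod.fst := by simp
    rw [e1, e2, isSystemWord_insert_iff p.2.2, ih]

lemma wordLoops_append_fill (P : List ((Bool × Bool) × {w // IsSystemWord w}))
    (x : List (Bool × Bool)) (h : IsSystemWord (x ++ P.map Prod.fst)) :
    wordLoops (x ++ fill P) =
      wordLoops (x ++ P.map Prod.fst) + (P.map fun p => wordLoops p.2.1).sum := by
  induction P generalizing x with
  | nil => rfl
  | cons p P ih =>
    have e1 : x ++ fill (p :: P) = (x ++ [p.1]) ++ p.2.1 ++ fill P := by simp [fill]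
    have e2 : x ++ (p :: P).map Prod.fst = (x ++ [p.1]) ++ P.map Prod.fst := by simp
    rw [e2] at h
    rw [e1, e2, wordLoops_insert ((isSystemWord_append_fill_iff P _).2 h) p.2.2, ih _ h,
      List.map_cons, List.sum_cons]
    omega

lemma length_fill (P : List ((Bool × Bool) × {w // IsSystemWord w})) :
    (fill P).length = P.length + (P.map fun p => p.2.1.length).sum := by
  induction P with
  | nil => rfl
  | cons p P ih =>
    simp only [fill, List.length_cons, List.length_append, ih, List.map_cons, List.sum_cons]
    omega

/-- A word is free of system words when no nonempty factor of it is a system word. -/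
def IsSystemFree (k : List (Bool × Bool)) : Prop :=
  ∀ x u y, k = x ++ u ++ y → IsSystemWord u → u = []

lemma IsSystemFree.tail {a : Bool × Bool} {k : List (Bool × Bool)} (h : IsSystemFree (a :: k)) :
    IsSystemFree k := fun x u y hk hu => h (a :: x) u y (by simp [hk]) hu

lemma IsIrreducibleWord.isSystemFree_tail {a : Bool × Bool} {k : List (Bool × Bool)}
    (h : IsIrreducibleWord (a :: k)) : IsSystemFree k := by
  intro x u y hk hu
  rcases h.2.2 (a :: x) u y (by simp [hk]) hu with h0 | h0
  · exact h0
  · have := congrArg List.length h0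
    rw [hk] at this
    simp only [List.length_cons, List.length_append] at this
    omega

/-- Reading a word from left to right and collecting in each step the longest prefix that is a
system word writes the word in the form `u ++ fill P` such that the letters of `P` are free of
system words. -/
lemma exists_eq_append_fill (w : List (Bool × Bool)) :
    ∃ (u : List (Bool × Bool)) (P : List ((Bool × Bool) × {w // IsSystemWord w})),
      w = u ++ fill P ∧ IsSystemWord u ∧ IsSystemFree (P.map Prod.fst) := by
  induction hn : w.length using Nat.strong_induction_on generalizing w with
  | _ n ih =>
    classical
    let p : ℕ → Prop := fun j => j ≤ w.length ∧ IsSystemWord (w.take j)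
    have hp0 : p 0 := ⟨Nat.zero_le _, by simpa using isSystemWord_nil⟩
    have hj := Nat.findGreatest_spec (P := p) (Nat.zero_le w.length) hp0
    have hmax : ∀ v z, w = v ++ z → IsSystemWord v →
        v.length ≤ Nat.findGreatest p w.length := fun v z hv hs =>
      Nat.le_findGreatest (by simp [hv]) ⟨by simp [hv], by simpa [hv] using hs⟩
    set j := Nat.findGreatest p w.length
    have hw : w = w.take j ++ w.drop j := (List.take_append_drop j w).symm
    have hlen : (w.take j).length = j := by simpa using hj.1
    have hs : IsSystemWord (w.take j) := hj.2
    generalize w.take j = u at hw hs hlen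
    generalize w.drop j = rest at hw
    cases rest with
    | nil => exact ⟨u, [], hw, hs, fun x v y h _ => by simp_all⟩
    | cons a w' =>
      obtain ⟨u', P', hw', hu', hP'⟩ := ih w'.length (by rw [← hn, hw]; simp; omega) w' rfl
      refine ⟨u, (a, ⟨u', hu'⟩) :: P', by rw [hw, hw']; rfl, hs, ?_⟩
      intro x v y hk hv
      rcases x with _ | ⟨b, x⟩
      · rcases v with _ | ⟨b, v⟩
        · rfl
        · exfalso
          simp only [List.map_cons, List.nil_append, List.cons_append, List.cons.injEq] at hk
          obtain ⟨rfl, hk⟩ := hk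
          obtain ⟨P1, P2, rfl, rfl, rfl⟩ := List.map_eq_append_iff.1 hk
          have h1 : IsSystemWord (fill ((a, ⟨u', hu'⟩) :: P1)) := by
            have := isSystemWord_append_fill_iff ((a, ⟨u', hu'⟩) :: P1) []
            exact this.2 hv
          have h2 := hmax (u ++ fill ((a, ⟨u', hu'⟩) :: P1)) (fill P2)
            (by rw [hw, hw', fill_append]; simp [fill]) (hs.append h1)
          simp only [fill, List.length_append, List.length_cons] at h2
          omega
      · simp only [List.map_cons, List.cons_append, List.cons.injEq] at hk
        exact hP' x v y hk.2 hv

lemma exists_irreducible_fill {w : List (Bool × Bool)} (hw : IsSystemWord w) (h0 : w ≠ []) :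
    ∃ P : List ((Bool × Bool) × {w // IsSystemWord w}),
      IsIrreducibleWord (P.map Prod.fst) ∧ fill P = w := by
  obtain ⟨a, w, rfl⟩ := List.exists_cons_of_ne_nil h0
  obtain ⟨u, P, rfl, hu, hP⟩ := exists_eq_append_fill w
  refine ⟨(a, ⟨u, hu⟩) :: P, ⟨?_, by simp, ?_⟩, rfl⟩
  · exact (isSystemWord_append_fill_iff ((a, ⟨u, hu⟩) :: P) []).1 hw
  · intro x v y hk hv
    rcases x with _ | ⟨b, x⟩
    · rcases v with _ | ⟨b, v⟩
      · exact .inl rfl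
      · refine .inr ?_
        have hk' : IsSystemWord (((a, (⟨u, hu⟩ : {w // IsSystemWord w})) :: P).map Prod.fst) :=
          (isSystemWord_append_fill_iff ((a, ⟨u, hu⟩) :: P) []).1 hw
        rw [hk] at hk' ⊢
        simp only [List.map_cons, List.nil_append, List.cons_append, List.cons.injEq] at hk
        have hy := hP v y [] (by simp [hk.2]) (hv.of_append_left (by simpa using hk'))
        simp [hy]
    · simp only [List.map_cons, List.cons_append, List.cons.injEq] at hk
      exact .inl (hP x v y hk.2 hv)

lemma exists_of_fill_eq_append {P : List ((Bool × Bool) × {w // IsSystemWord w})}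
    {v z : List (Bool × Bool)} (h : fill P = v ++ z) (hv : v ≠ []) :
    ∃ k k' u u', P.map Prod.fst = k ++ k' ∧ k ≠ [] ∧ IsSystemWord (u ++ u') ∧
      ∀ x, IsSystemWord (x ++ v) ↔ IsSystemWord (x ++ k ++ u) := by
  induction P generalizing v with
  | nil =>
    rw [fill] at h
    simp_all
  | cons p P ih =>
    obtain ⟨a, v, rfl⟩ := List.exists_cons_of_ne_nil hv
    obtain ⟨b, u⟩ := p
    simp only [fill, List.cons_append, List.cons.injEq] at h
    obtain ⟨rfl, h⟩ := h
    have hbase : ∀ c, u.1 = v ++ c → ∃ k k' u' u'', ((b, u) :: P).map Prod.fst = k ++ k' ∧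
        k ≠ [] ∧ IsSystemWord (u' ++ u'') ∧
          ∀ x, IsSystemWord (x ++ b :: v) ↔ IsSystemWord (x ++ k ++ u') := fun c hc =>
      ⟨[b], P.map Prod.fst, v, c, rfl, by simp, hc ▸ u.2, fun x => by simp⟩
    rcases List.append_eq_append_iff.1 h with ⟨c, hc, hc'⟩ | ⟨c, hc, hc'⟩
    · by_cases h0 : c = []
      · exact hbase [] (by simp [hc, h0])
      · obtain ⟨k, k', u', u'', h1, h2, h3, h4⟩ := ih hc' h0
        refine ⟨b :: k, k', u', u'', by simp [h1], by simp, h3, fun x => ?_⟩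
        have e1 : x ++ b :: v = (x ++ [b]) ++ u.1 ++ c := by simp [hc]
        have e2 : x ++ b :: k ++ u' = (x ++ [b]) ++ k ++ u' := by simp
        rw [e1, e2, isSystemWord_insert_iff u.2, h4]
    · exact hbase c hc

/-- A filling of a word free of system words does not start with a nonempty system word. -/
lemma eq_nil_of_fill_eq_append {P : List ((Bool × Bool) × {w // IsSystemWord w})}
    (hP : IsSystemFree (P.map Prod.fst)) {v z : List (Bool × Bool)} (h : fill P = v ++ z)
    (hv : IsSystemWord v) : v = [] := by
  by_contra h0
  obtain ⟨k, k', u, u', h1, h2, h3, h4⟩ := exists_of_fill_eq_append h h0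
  have h5 : IsSystemWord (k ++ u) := by simpa using (h4 []).1 (by simpa using hv)
  exact h2 (hP [] k k' h1 ((h3.of_overlap h5).of_append_right h5))

lemma eq_of_append_fill_eq {P P' : List ((Bool × Bool) × {w // IsSystemWord w})}
    {u u' : List (Bool × Bool)} (hP : IsSystemFree (P.map Prod.fst))
    (hP' : IsSystemFree (P'.map Prod.fst)) (hu : IsSystemWord u) (hu' : IsSystemWord u')
    (h : u ++ fill P = u' ++ fill P') : u = u' := by
  rcases List.append_eq_append_iff.1 h with ⟨c, rfl, hc⟩ | ⟨c, rfl, hc⟩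
  · simp [eq_nil_of_fill_eq_append hP hc (hu.of_append_left hu')]
  · simp [eq_nil_of_fill_eq_append hP' hc (hu'.of_append_left hu)]

lemma append_fill_injective {P P' : List ((Bool × Bool) × {w // IsSystemWord w})}
    {u u' : List (Bool × Bool)} (hP : IsSystemFree (P.map Prod.fst))
    (hP' : IsSystemFree (P'.map Prod.fst)) (hu : IsSystemWord u) (hu' : IsSystemWord u')
    (h : u ++ fill P = u' ++ fill P') : u = u' ∧ P = P' := by
  induction P generalizing P' u u' with
  | nil =>
    obtain rfl := eq_of_append_fill_eq hP hP' hu hu' h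
    cases P' with
    | nil => exact ⟨rfl, rfl⟩
    | cons p' P' => simp [fill] at h
  | cons p P ih =>
    obtain rfl := eq_of_append_fill_eq hP hP' hu hu' h
    cases P' with
    | nil => simp [fill] at h
    | cons p' P' =>
      obtain ⟨a, v, hv⟩ := p
      obtain ⟨a', v', hv'⟩ := p'
      simp only [fill, List.append_cancel_left_eq, List.cons.injEq] at h
      obtain ⟨rfl, h⟩ := h
      obtain ⟨rfl, rfl⟩ := ih hP.tail hP'.tail hv hv' h
      exact ⟨rfl, rfl⟩

lemma fill_injective {P P' : List ((Bool × Bool) × {w // IsSystemWord w})}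
    (hP : IsIrreducibleWord (P.map Prod.fst)) (hP' : IsIrreducibleWord (P'.map Prod.fst))
    (h : fill P = fill P') : P = P' := by
  rcases P with _ | ⟨⟨a, v, hv⟩, P⟩
  · exact absurd rfl hP.2.1
  rcases P' with _ | ⟨⟨a', v', hv'⟩, P'⟩
  · exact absurd rfl hP'.2.1
  simp only [fill, List.cons.injEq] at h
  obtain ⟨rfl, h⟩ := h
  obtain ⟨rfl, rfl⟩ := append_fill_injective hP.isSystemFree_tail hP'.isSystemFree_tail hv hv' h
  rfl

/-! ### The functional equation of the generating function -/

/-- The generating function `∑ q ^ (s x).1 * t ^ (s x).2` over all `x`, as a power series in the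
variable `q` whose coefficients are power series in `t`. A pair of exponents that occurs infinitely
often gets the coefficient zero. -/
noncomputable def genFun {T : Type*} (s : T → ℕ × ℕ) : ℚ⟦X⟧⟦X⟧ :=
  PowerSeries.mk fun r => PowerSeries.mk fun n => (Nat.card {x // s x = (r, n)} : ℚ)

lemma coeff_genFun {T : Type*} (s : T → ℕ × ℕ) (r n : ℕ) :
    (PowerSeries.coeff n) ((PowerSeries.coeff r) (genFun s)) =
      (Nat.card {x // s x = (r, n)} : ℚ) := by
  simp [genFun]

lemma genFun_congr {T U : Type*} {s : T → ℕ × ℕ} {s' : U → ℕ × ℕ} (e : T ≃ U)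
    (h : ∀ x, s' (e x) = s x) : genFun s = genFun s' := by
  ext r n
  rw [coeff_genFun, coeff_genFun,
    Nat.card_congr (e.subtypeEquiv (q := fun y => s' y = (r, n)) fun x => by rw [h])]

/-- A pair with given total exponents, sorted by the exponents of its two entries. -/
def fibreProdEquiv {T U : Type*} (s : T → ℕ × ℕ) (s' : U → ℕ × ℕ) (r n : ℕ) :
    {x : T × U // s x.1 + s' x.2 = (r, n)} ≃
      Σ i : Finset.HasAntidiagonal.antidiagonal r × Finset.HasAntidiagonal.antidiagonal n,
        {x // s x = (i.1.1.1, i.2.1.1)} × {y // s' y = (i.1.1.2, i.2.1.2)} where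
  toFun x := ⟨(⟨((s x.1.1).1, (s' x.1.2).1), by simpa using congrArg Prod.fst x.2⟩,
    ⟨((s x.1.1).2, (s' x.1.2).2), by simpa using congrArg Prod.snd x.2⟩),
    ⟨x.1.1, rfl⟩, ⟨x.1.2, rfl⟩⟩
  invFun y := ⟨(y.2.1.1, y.2.2.1), by
    simp only [y.2.1.2, y.2.2.2]
    exact Prod.ext (Finset.HasAntidiagonal.mem_antidiagonal.1 y.1.1.2)
      (Finset.HasAntidiagonal.mem_antidiagonal.1 y.1.2.2)⟩
  left_inv x := rfl
  right_inv := by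
    rintro ⟨⟨⟨⟨i, j⟩, hi⟩, ⟨⟨k, l⟩, hk⟩⟩, ⟨x, hx⟩, ⟨y, hy⟩⟩
    simp only at hx hy
    have h1 := congrArg Prod.fst hx
    have h2 := congrArg Prod.snd hx
    have h3 := congrArg Prod.fst hy
    have h4 := congrArg Prod.snd hy
    simp only at h1 h2 h3 h4
    subst h1 h2 h3 h4
    rfl

lemma finite_fibre_prod {T U : Type*} {s : T → ℕ × ℕ} {s' : U → ℕ × ℕ}
    (hs : ∀ p, Finite {x // s x = p}) (hs' : ∀ p, Finite {x // s' x = p}) (p : ℕ × ℕ) :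
    Finite {x : T × U // s x.1 + s' x.2 = p} :=
  .of_equiv _ (fibreProdEquiv s s' p.1 p.2).symm

lemma genFun_prod {T U : Type*} {s : T → ℕ × ℕ} {s' : U → ℕ × ℕ}
    (hs : ∀ p, Finite {x // s x = p}) (hs' : ∀ p, Finite {x // s' x = p}) :
    genFun (fun x : T × U => s x.1 + s' x.2) = genFun s * genFun s' := by
  ext r n
  have hL : (Nat.card {x : T × U // s x.1 + s' x.2 = (r, n)} : ℚ) =
      ∑ i : Finset.HasAntidiagonal.antidiagonal r, ∑ j : Finset.HasAntidiagonal.antidiagonal n,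
        (Nat.card {x // s x = (i.1.1, j.1.1)} : ℚ) * Nat.card {y // s' y = (i.1.2, j.1.2)} := by
    rw [Nat.card_congr (fibreProdEquiv s s' r n), Nat.card_sigma, Fintype.sum_prod_type]
    push_cast
    simp only [Nat.card_prod, Nat.cast_mul]
  rw [coeff_genFun, hL, PowerSeries.coeff_mul, map_sum,
    ← Finset.sum_coe_sort (M := ℚ) (Finset.HasAntidiagonal.antidiagonal r)]
  refine Finset.sum_congr rfl fun i _ => ?_
  rw [PowerSeries.coeff_mul,
    ← Finset.sum_coe_sort (M := ℚ) (Finset.HasAntidiagonal.antidiagonal n)]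
  refine Finset.sum_congr rfl fun j _ => ?_
  rw [coeff_genFun, coeff_genFun]

lemma genFun_unit (e m : ℕ) :
    genFun (fun _ : Unit => (e, m)) = PowerSeries.X ^ e * PowerSeries.C (PowerSeries.X ^ m) := by
  ext r n
  rw [coeff_genFun, PowerSeries.coeff_mul_C, PowerSeries.coeff_X_pow]
  by_cases h1 : r = e
  · by_cases h2 : n = m
    · subst h1 h2
      simp
    · have : IsEmpty {x : Unit // (e, m) = (r, n)} := ⟨fun x => h2 (congrArg Prod.snd x.2).symm⟩
      rw [Nat.card_of_isEmpty]
      simp [h1, PowerSeries.coeff_X_pow, h2]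
  · have : IsEmpty {x : Unit // (e, m) = (r, n)} := ⟨fun x => h1 (congrArg Prod.fst x.2).symm⟩
    rw [Nat.card_of_isEmpty]
    simp [h1]

/-- Half the number of points minus the number of loops, and half the number of points. -/
noncomputable def wordSize (w : List (Bool × Bool)) : ℕ × ℕ :=
  (w.length / 2 - wordLoops w, w.length / 2)

lemma IsSystemWord.wordSize_eq_iff {w : List (Bool × Bool)} (hw : IsSystemWord w) {r n : ℕ} :
    wordSize w = (r, n) ↔ w.length = 2 * n ∧ wordLoops w + r = n := by
  have h1 := hw.two_mul_wordLoops_le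
  obtain ⟨k, hk⟩ := hw.even_length
  rw [wordSize, Prod.mk.injEq]
  omega

lemma finite_fibre_wordSize (p : ℕ × ℕ) :
    Finite {w : {w // IsSystemWord w} // wordSize w.1 = p} := by
  have : Finite {l : List (Bool × Bool) // l.length = 2 * p.2} := List.finite_length_eq _ _
  refine Finite.of_injective (β := {l : List (Bool × Bool) // l.length = 2 * p.2})
    (fun w => ⟨w.1.1, (w.1.2.wordSize_eq_iff.1 w.2).1⟩) fun w w' h => ?_
  exact Subtype.ext (Subtype.ext (Subtype.mk.inj h))

/-- The generating function `∑ q ^ (n - k) * t ^ n` of all meandric systems, where `2 * n` is the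
number of points and `k` the number of loops. -/
noncomputable def systemGenFun : ℚ⟦X⟧⟦X⟧ :=
  genFun fun w : {w // IsSystemWord w} => wordSize w.1

/-- The total size of the system words of a filling. -/
noncomputable def fillingSize (P : List ((Bool × Bool) × {w // IsSystemWord w})) : ℕ × ℕ :=
  (P.map fun p => wordSize p.2.1).sum

lemma wordSize_fill {P : List ((Bool × Bool) × {w // IsSystemWord w})}
    (h : IsSystemWord (P.map Prod.fst)) :
    wordSize (fill P) = wordSize (P.map Prod.fst) + fillingSize P := by
  have key : ∀ P : List ((Bool × Bool) × {w // IsSystemWord w}),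
      (P.map fun p => p.2.1.length).sum = 2 * (fillingSize P).2 ∧
      (P.map fun p => wordLoops p.2.1).sum + (fillingSize P).1 = (fillingSize P).2 := by
    intro P
    induction P with
    | nil => simp [fillingSize]
    | cons p P ih =>
      have h2 := (p.2.2.wordSize_eq_iff (r := (wordSize p.2.1).1) (n := (wordSize p.2.1).2)).1 rfl
      have h3 : fillingSize (p :: P) = wordSize p.2.1 + fillingSize P := by simp [fillingSize]
      rw [h3, Prod.fst_add, Prod.snd_add, List.map_cons, List.sum_cons, List.map_cons,
        List.sum_cons]
      omega
  obtain ⟨k1, k2⟩ := key P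
  have h1 := wordLoops_append_fill P [] h
  have h2 := length_fill P
  obtain ⟨h3, h4⟩ := (h.wordSize_eq_iff (r := (wordSize (P.map Prod.fst)).1)
    (n := (wordSize (P.map Prod.fst)).2)).1 rfl
  rw [List.length_map] at h3
  simp only [List.nil_append] at h1
  have hfill : IsSystemWord (fill P) := (isSystemWord_append_fill_iff P []).2 h
  refine hfill.wordSize_eq_iff.2 ?_
  rw [h1, h2]
  omega

lemma genFun_fillings (k : List (Bool × Bool)) :
    (∀ p, Finite {P : {P : List ((Bool × Bool) × {w // IsSystemWord w}) // P.map Prod.fst = k} //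
      fillingSize P.1 = p}) ∧
    genFun (fun P : {P : List ((Bool × Bool) × {w // IsSystemWord w}) // P.map Prod.fst = k} =>
      fillingSize P.1) = systemGenFun ^ k.length := by
  induction k with
  | nil =>
    have hu : ∀ P : {P : List ((Bool × Bool) × {w // IsSystemWord w}) // P.map Prod.fst = []},
        P = ⟨[], rfl⟩ := fun P => Subtype.ext (List.map_eq_nil_iff.1 P.2)
    have : Finite {P : List ((Bool × Bool) × {w // IsSystemWord w}) // P.map Prod.fst = []} :=
      @Finite.of_subsingleton _ ⟨fun P Q => by rw [hu P, hu Q]⟩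
    refine ⟨fun p => inferInstance, ?_⟩
    rw [genFun_congr (s' := fun _ : Unit => ((0, 0) : ℕ × ℕ)) ⟨fun _ => (), fun _ => ⟨[], rfl⟩,
      fun P => (hu P).symm, fun _ => rfl⟩ fun P => by rw [hu P]; rfl, genFun_unit]
    simp
  | cons a k ih =>
    let e : {w // IsSystemWord w} ×
        {P : List ((Bool × Bool) × {w // IsSystemWord w}) // P.map Prod.fst = k} ≃
        {P : List ((Bool × Bool) × {w // IsSystemWord w}) // P.map Prod.fst = a :: k} :=
      Equiv.ofBijective (fun x => ⟨(a, x.1) :: x.2.1, by simp [x.2.2]⟩) (by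
        constructor
        · rintro ⟨w, P, hP⟩ ⟨w', P', hP'⟩ h
          simpa using h
        · rintro ⟨_ | ⟨⟨b, w⟩, P⟩, hP⟩
          · simp at hP
          · simp only [List.map_cons, List.cons.injEq] at hP
            obtain ⟨rfl, hP'⟩ := hP
            exact ⟨(w, ⟨P, hP'⟩), rfl⟩)
    have he : ∀ x, fillingSize (e x).1 = wordSize x.1.1 + fillingSize x.2.1 := fun x => by
      have : (e x).1 = (a, x.1) :: x.2.1 := rfl
      simp [this, fillingSize]
    refine ⟨fun p => ?_, ?_⟩
    · have := finite_fibre_prod finite_fibre_wordSize ih.1 p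
      exact .of_equiv _ (e.subtypeEquiv (p := fun x => wordSize x.1.1 + fillingSize x.2.1 = p)
        (q := fun P => fillingSize P.1 = p) fun x => by rw [he])
    · rw [← genFun_congr e he, genFun_prod finite_fibre_wordSize ih.1, ih.2, List.length_cons,
        pow_succ']
      rfl

/-- For irreducible systems other than the circle, the number of points is at most four times the
exponent of `q`. -/
lemma finite_irreducible_words (r : ℕ) :
    {k : List (Bool × Bool) | IsIrreducibleWord k ∧ (wordSize k).1 ≤ r}.Finite := by
  refine (List.finite_length_le (Bool × Bool) (4 * r + 2)).subset fun k hk => ?_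
  obtain ⟨h1, h2⟩ := (hk.1.1.wordSize_eq_iff (r := (wordSize k).1) (n := (wordSize k).2)).1 rfl
  by_cases h : k = circleWord
  · subst h
    simp [circleWord]
  · have h3 := hk.1.four_mul_wordLoops_le h
    have h4 := hk.2
    simp only [Set.mem_ofPred_eq]
    omega

/-- A nonempty system is an irreducible system whose gaps are filled with arbitrary systems. -/
lemma card_systemWords (r n : ℕ) :
    Nat.card {w : {w // IsSystemWord w} // wordSize w.1 = (r, n)} =
      Nat.card {_x : Unit // ((0, 0) : ℕ × ℕ) = (r, n)} +
        ∑ k ∈ (finite_irreducible_words r).toFinset,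
          Nat.card {x : Unit × {P : List ((Bool × Bool) × {w // IsSystemWord w}) //
            P.map Prod.fst = k} // wordSize k + fillingSize x.2.1 = (r, n)} := by
  classical
  have hfin : ∀ k : List (Bool × Bool), Finite {x : Unit × {P : List ((Bool × Bool) ×
      {w // IsSystemWord w}) // P.map Prod.fst = k} //
      wordSize k + fillingSize x.2.1 = (r, n)} := fun k =>
    finite_fibre_prod (s := fun _ : Unit => wordSize k) (fun _ => inferInstance)
      (genFun_fillings k).1 (r, n)
  rw [← Finset.sum_coe_sort, ← Nat.card_sigma, ← Nat.card_sum]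
  have hirr : ∀ k : (finite_irreducible_words r).toFinset, IsIrreducibleWord k.1 := fun k =>
    ((finite_irreducible_words r).mem_toFinset.1 k.2).1
  symm
  refine Nat.card_congr (Equiv.ofBijective (Sum.elim (fun x => ⟨⟨[], isSystemWord_nil⟩, ?_⟩)
    fun x => ⟨⟨fill x.2.1.2.1, ?_⟩, ?_⟩) ⟨?_, ?_⟩)
  · rw [← x.2]
    simp [wordSize]
  · exact (isSystemWord_append_fill_iff x.2.1.2.1 []).2 (by simpa [x.2.1.2.2] using (hirr x.1).1)
  · rw [wordSize_fill (by rw [x.2.1.2.2]; exact (hirr x.1).1), x.2.1.2.2]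
    exact x.2.2
  · rintro (⟨x, hx⟩ | ⟨k, ⟨⟨⟩, P, hP⟩, h⟩) (⟨x', hx'⟩ | ⟨k', ⟨⟨⟩, P', hP'⟩, h'⟩) he
    · rfl
    · exfalso
      have he' : [] = fill P' := congrArg (fun w => w.1.1) he
      have := (hirr k').2.1
      rw [← hP'] at this
      rcases P' with _ | ⟨p, P'⟩
      · exact this rfl
      · simp [fill] at he'
    · exfalso
      have he' : fill P = [] := congrArg (fun w => w.1.1) he
      have := (hirr k).2.1
      rw [← hP] at this
      rcases P with _ | ⟨p, P⟩
      · exact this rfl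
      · simp [fill] at he'
    · have he' : fill P = fill P' := congrArg (fun w => w.1.1) he
      obtain rfl : P = P' := fill_injective (by rw [hP]; exact hirr k)
        (by rw [hP']; exact hirr k') he'
      obtain rfl : k = k' := Subtype.ext (hP.symm.trans hP')
      rfl
  · rintro ⟨⟨w, hw⟩, h⟩
    by_cases h0 : w = []
    · subst h0
      refine ⟨.inl ⟨(), ?_⟩, rfl⟩
      rw [← h]
      simp [wordSize]
    · obtain ⟨P, hP, rfl⟩ := exists_irreducible_fill hw h0
      have h1 := wordSize_fill hP.1
      have h2 : wordSize (P.map Prod.fst) + fillingSize P = (r, n) := h1.symm.trans h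
      refine ⟨.inr ⟨⟨P.map Prod.fst, ?_⟩, ⟨⟨(), P, rfl⟩, h2⟩⟩, rfl⟩
      rw [Set.Finite.mem_toFinset]
      refine ⟨hP, ?_⟩
      have := congrArg Prod.fst h2
      simp only [Prod.fst_add] at this
      omega

lemma coeff_systemGenFun (r : ℕ) :
    (PowerSeries.coeff r) systemGenFun = (PowerSeries.coeff r)
      (1 + ∑ k ∈ (finite_irreducible_words r).toFinset, PowerSeries.X ^ (wordSize k).1 *
        PowerSeries.C (PowerSeries.X ^ (wordSize k).2) * systemGenFun ^ k.length) := by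
  have h1 : (1 : ℚ⟦X⟧⟦X⟧) = genFun fun _ : Unit => ((0, 0) : ℕ × ℕ) := by
    rw [genFun_unit]; simp
  have h2 : ∀ k : List (Bool × Bool), PowerSeries.X ^ (wordSize k).1 *
      PowerSeries.C (PowerSeries.X ^ (wordSize k).2) * systemGenFun ^ k.length =
      genFun fun x : Unit × {P : List ((Bool × Bool) × {w // IsSystemWord w}) //
        P.map Prod.fst = k} => wordSize k + fillingSize x.2.1 := by
    intro k
    rw [← (genFun_fillings k).2, ← genFun_unit]
    exact (genFun_prod (s := fun _ : Unit => wordSize k) (fun _ => inferInstance)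
      (genFun_fillings k).1).symm
  ext n
  simp only [h2]
  rw [h1, map_add, map_sum, map_add, map_sum, systemGenFun, coeff_genFun, card_systemWords]
  simp only [coeff_genFun]
  push_cast
  rfl

lemma isIrreducibleWord_circleWord : IsIrreducibleWord circleWord := by
  refine ⟨⟨isBalanced_pair, isBalanced_pair⟩, by simp [circleWord], fun x u y h hu => ?_⟩
  obtain ⟨m, hm⟩ := hu.even_length
  have hl := congrArg List.length h
  simp only [circleWord, List.length_append, List.length_cons, List.length_nil] at hl
  rcases Nat.eq_zero_or_pos m with h0 | h0
  · exact .inl (List.length_eq_zero_iff.1 (by omega))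
  · have hx : x = [] := List.length_eq_zero_iff.1 (by omega)
    have hy : y = [] := List.length_eq_zero_iff.1 (by omega)
    exact .inr (by simp [h, hx, hy])

lemma wordSize_circleWord : wordSize circleWord = (0, 1) := by
  have h := isIrreducibleWord_circleWord
  refine h.1.wordSize_eq_iff.2 ⟨rfl, ?_⟩
  have h1 := h.1.wordLoops_pos h.2.1
  have h2 := h.1.two_mul_wordLoops_le
  simp only [circleWord, List.length_cons, List.length_nil] at h1 h2 ⊢
  omega

/-- The functional equation `M = 1 + t * M ^ 2 + ∑ q ^ e * (t * M ^ 2) ^ m` for the generating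
function `M` of meandric systems, in every degree `r` of `q`. The sum is over the irreducible
systems on `2 * m` points with `m - e` loops that are not the circle. -/
lemma coeff_systemGenFun_eq (r : ℕ) :
    ∃ (T : Finset (List (Bool × Bool))) (e m : List (Bool × Bool) → ℕ),
    (∀ k ∈ T, e k + 1 ≤ m k ∧ m k ≤ 2 * e k ∧ e k ≤ r) ∧
    (PowerSeries.coeff r) systemGenFun = (PowerSeries.coeff r)
      (1 + PowerSeries.C PowerSeries.X * systemGenFun ^ 2 +
        ∑ k ∈ T, PowerSeries.X ^ (e k) *
          (PowerSeries.C PowerSeries.X * systemGenFun ^ 2) ^ (m k)) := by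
  classical
  refine ⟨(finite_irreducible_words r).toFinset.erase circleWord, fun k => (wordSize k).1,
    fun k => (wordSize k).2, fun k hk => ?_, ?_⟩
  · rw [Finset.mem_erase, Set.Finite.mem_toFinset] at hk
    obtain ⟨hne, hk, hr⟩ := hk
    obtain ⟨h1, h2⟩ := (hk.1.wordSize_eq_iff (r := (wordSize k).1) (n := (wordSize k).2)).1 rfl
    have h3 := hk.four_mul_wordLoops_le hne
    have h4 := hk.1.wordLoops_pos hk.2.1
    simp only
    omega
  · have hmem : circleWord ∈ (finite_irreducible_words r).toFinset := by
      rw [Set.Finite.mem_toFinset]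
      exact ⟨isIrreducibleWord_circleWord, by simp [wordSize_circleWord]⟩
    rw [coeff_systemGenFun, ← Finset.add_sum_erase _ _ hmem, wordSize_circleWord, ← add_assoc]
    congr 2
    · simp [circleWord]
    · refine Finset.sum_congr rfl fun k hk => ?_
      rw [Finset.mem_erase, Set.Finite.mem_toFinset] at hk
      obtain ⟨h1, -⟩ := (hk.2.1.1.wordSize_eq_iff (r := (wordSize k).1)
        (n := (wordSize k).2)).1 rfl
      rw [mul_pow, ← pow_mul, ← h1, map_pow, mul_assoc]

/-! ### Rationality of the coefficients -/

/-- The series `w ^ d * (1 - w) ^ (-2 * d) * p` with a polynomial `p` of degree at most `3 * d`.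
For varying `d` these are the pieces of a graded ring. -/
def IsRationalPiece (d : ℕ) (f : ℚ⟦X⟧) : Prop :=
  ∃ p : Polynomial ℚ, p.natDegree ≤ 3 * d ∧
    f * (1 - PowerSeries.X) ^ (2 * d) = PowerSeries.X ^ d * (p : ℚ⟦X⟧)

/-- The series `w ^ (r + 1) * (1 - w) ^ (c - 2 * r) * p` with a polynomial `p` of degree at most
`3 * r - 3`. The coefficient `Y_r` has this form with `c = 1`, and `(1 - w) * Y_r` with `c = 2`. -/
def IsReducedPiece (c r : ℕ) (f : ℚ⟦X⟧) : Prop :=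
  ∃ p : Polynomial ℚ, p.natDegree ≤ 3 * r - 3 ∧
    f * (1 - PowerSeries.X) ^ (2 * r - c) = PowerSeries.X ^ (r + 1) * (p : ℚ⟦X⟧)

lemma IsRationalPiece.sum {ι : Type*} {d : ℕ} {s : Finset ι} {f : ι → ℚ⟦X⟧}
    (h : ∀ i ∈ s, IsRationalPiece d (f i)) : IsRationalPiece d (∑ i ∈ s, f i) := by
  choose! p hp hp' using h
  refine ⟨∑ i ∈ s, p i, Polynomial.natDegree_sum_le_of_forall_le _ _ hp, ?_⟩
  rw [Finset.sum_mul, Finset.sum_congr rfl hp', ← Finset.mul_sum]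
  congr 1
  exact (map_sum (Polynomial.coeToPowerSeries.ringHom (R := ℚ)) p s).symm

lemma IsReducedPiece.sum {ι : Type*} {c r : ℕ} {s : Finset ι} {f : ι → ℚ⟦X⟧}
    (h : ∀ i ∈ s, IsReducedPiece c r (f i)) : IsReducedPiece c r (∑ i ∈ s, f i) := by
  choose! p hp hp' using h
  refine ⟨∑ i ∈ s, p i, Polynomial.natDegree_sum_le_of_forall_le _ _ hp, ?_⟩
  rw [Finset.sum_mul, Finset.sum_congr rfl hp', ← Finset.mul_sum]
  congr 1
  exact (map_sum (Polynomial.coeToPowerSeries.ringHom (R := ℚ)) p s).symm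

lemma IsReducedPiece.add {c r : ℕ} {f g : ℚ⟦X⟧} (hf : IsReducedPiece c r f)
    (hg : IsReducedPiece c r g) : IsReducedPiece c r (f + g) := by
  obtain ⟨p, hp, hp'⟩ := hf
  obtain ⟨q, hq, hq'⟩ := hg
  exact ⟨p + q, Polynomial.natDegree_add_le_of_degree_le hp hq, by
    rw [add_mul, hp', hq', Polynomial.coe_add, mul_add]⟩

lemma IsRationalPiece.mul {d d' : ℕ} {f g : ℚ⟦X⟧} (hf : IsRationalPiece d f)
    (hg : IsRationalPiece d' g) : IsRationalPiece (d + d') (f * g) := by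
  obtain ⟨p, hp, hp'⟩ := hf
  obtain ⟨q, hq, hq'⟩ := hg
  refine ⟨p * q, Polynomial.natDegree_mul_le.trans (by omega), ?_⟩
  calc f * g * (1 - PowerSeries.X) ^ (2 * (d + d'))
      = (f * (1 - PowerSeries.X) ^ (2 * d)) * (g * (1 - PowerSeries.X) ^ (2 * d')) := by ring
    _ = _ := by rw [hp', hq', Polynomial.coe_mul]; ring

lemma isRationalPiece_one : IsRationalPiece 0 1 := ⟨1, by simp, by simp⟩

lemma IsReducedPiece.isRationalPiece {r : ℕ} (hr : 1 ≤ r) {f : ℚ⟦X⟧} (hf : IsReducedPiece 1 r f) :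
    IsRationalPiece r f := by
  obtain ⟨p, hp, hp'⟩ := hf
  refine ⟨Polynomial.X * (1 - Polynomial.X) * p, ?_, ?_⟩
  · have h1 : (1 - Polynomial.X : Polynomial ℚ).natDegree ≤ 1 :=
      (Polynomial.natDegree_sub_le _ _).trans (by simp)
    have h2 : (Polynomial.X * (1 - Polynomial.X) : Polynomial ℚ).natDegree ≤ 2 :=
      Polynomial.natDegree_mul_le.trans (by rw [Polynomial.natDegree_X]; omega)
    exact Polynomial.natDegree_mul_le.trans (by omega)
  · rw [show 2 * r = 2 * r - 1 + 1 by omega, pow_succ, ← mul_assoc, hp']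
    push_cast
    ring

lemma isRationalPiece_coeff_pow {Y : ℚ⟦X⟧⟦X⟧} {r : ℕ}
    (h : ∀ i < r, IsRationalPiece i (PowerSeries.coeff i Y)) (k : ℕ) :
    ∀ i < r, IsRationalPiece i (PowerSeries.coeff i (Y ^ k)) := by
  induction k with
  | zero =>
    intro i _
    rw [pow_zero, PowerSeries.coeff_one]
    split_ifs with h0
    · rw [h0]; exact isRationalPiece_one
    · exact ⟨0, by simp, by simp⟩
  | succ k ih =>
    intro i hi
    rw [pow_succ, PowerSeries.coeff_mul]
    refine IsRationalPiece.sum fun x hx => ?_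
    have := Finset.HasAntidiagonal.mem_antidiagonal.1 hx
    rw [← this]
    exact (ih _ (by omega)).mul (h _ (by omega))

lemma IsReducedPiece.X_mul_mul {i j : ℕ} (hi : 1 ≤ i) (hj : 1 ≤ j) {f g : ℚ⟦X⟧}
    (hf : IsReducedPiece 1 i f) (hg : IsReducedPiece 1 j g) :
    IsReducedPiece 2 (i + j) (PowerSeries.X * (f * g)) := by
  obtain ⟨p, hp, hp'⟩ := hf
  obtain ⟨q, hq, hq'⟩ := hg
  refine ⟨Polynomial.X ^ 2 * (p * q), ?_, ?_⟩
  · have h1 : (p * q).natDegree ≤ _ := Polynomial.natDegree_mul_le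
    refine Polynomial.natDegree_mul_le.trans ?_
    rw [Polynomial.natDegree_X_pow]
    omega
  · rw [show 2 * (i + j) - 2 = (2 * i - 1) + (2 * j - 1) by omega, pow_add]
    calc PowerSeries.X * (f * g) * ((1 - PowerSeries.X) ^ (2 * i - 1) *
          (1 - PowerSeries.X) ^ (2 * j - 1))
        = PowerSeries.X * ((f * (1 - PowerSeries.X) ^ (2 * i - 1)) *
          (g * (1 - PowerSeries.X) ^ (2 * j - 1))) := by ring
      _ = _ := by
        rw [hp', hq']
        push_cast
        ring

lemma IsRationalPiece.X_pow_mul {r e m : ℕ} (hm : e + 1 ≤ m) (hm' : m ≤ 2 * e) (her : e ≤ r)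
    {f : ℚ⟦X⟧} (hf : IsRationalPiece (r - e) f) :
    IsReducedPiece 2 r (PowerSeries.X ^ m * f) := by
  obtain ⟨p, hp, hp'⟩ := hf
  refine ⟨Polynomial.X ^ (m - e - 1) * ((1 - Polynomial.X) ^ (2 * e - 2) * p), ?_, ?_⟩
  · have h1 : (1 - Polynomial.X : Polynomial ℚ).natDegree ≤ 1 :=
      (Polynomial.natDegree_sub_le _ _).trans (by simp)
    have h2 : ((1 - Polynomial.X : Polynomial ℚ) ^ (2 * e - 2)).natDegree ≤ 2 * e - 2 :=
      Polynomial.natDegree_pow_le.trans (by simpa using Nat.mul_le_mul_left (2 * e - 2) h1)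
    have h3 : ((1 - Polynomial.X : Polynomial ℚ) ^ (2 * e - 2) * p).natDegree ≤ _ :=
      Polynomial.natDegree_mul_le
    refine Polynomial.natDegree_mul_le.trans ?_
    rw [Polynomial.natDegree_X_pow]
    omega
  · have e1 : 2 * r - 2 = 2 * (r - e) + (2 * e - 2) := by omega
    have e2 : (PowerSeries.X : ℚ⟦X⟧) ^ m * PowerSeries.X ^ (r - e) =
        PowerSeries.X ^ (r + 1) * PowerSeries.X ^ (m - e - 1) := by
      rw [← pow_add, ← pow_add]
      congr 1
      omega
    rw [e1, pow_add]
    calc PowerSeries.X ^ m * f * ((1 - PowerSeries.X) ^ (2 * (r - e)) *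
          (1 - PowerSeries.X) ^ (2 * e - 2))
        = PowerSeries.X ^ m * (f * (1 - PowerSeries.X) ^ (2 * (r - e))) *
          (1 - PowerSeries.X) ^ (2 * e - 2) := by ring
      _ = (PowerSeries.X ^ m * PowerSeries.X ^ (r - e)) * ((1 - PowerSeries.X) ^ (2 * e - 2) *
          (p : ℚ⟦X⟧)) := by rw [hp']; ring
      _ = _ := by
        rw [e2]
        push_cast
        ring

/-- The equation `(1 + w) * Y = 1 + w * Y ^ 2 + ∑ q ^ e * (w * Y ^ 2) ^ m` in degree `r` of `q`,
with a finite sum over exponents `e < m ≤ 2 * e`. The sum is indexed by words because different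
irreducible systems may have the same exponents. -/
def SatisfiesEquation (Y : ℚ⟦X⟧⟦X⟧) (r : ℕ) : Prop :=
  ∃ (T : Finset (List (Bool × Bool))) (e m : List (Bool × Bool) → ℕ),
    (∀ k ∈ T, e k + 1 ≤ m k ∧ m k ≤ 2 * e k ∧ e k ≤ r) ∧
    PowerSeries.coeff r (PowerSeries.C (1 + PowerSeries.X) * Y) = PowerSeries.coeff r
      (1 + PowerSeries.C PowerSeries.X * Y ^ 2 +
        ∑ k ∈ T, PowerSeries.X ^ (e k) * (PowerSeries.C PowerSeries.X * Y ^ 2) ^ (m k))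

/-- In degree zero the equation reads `(Y₀ - 1) * (w * Y₀ - 1) = 0`. -/
lemma coeff_zero_of_equation {Y : ℚ⟦X⟧⟦X⟧} (h : SatisfiesEquation Y 0) :
    PowerSeries.coeff 0 Y = 1 := by
  obtain ⟨T, e, m, hT, h⟩ := h
  obtain rfl : T = ∅ := Finset.eq_empty_of_forall_notMem fun k hk => by have := hT k hk; omega
  simp only [Finset.sum_empty, add_zero, PowerSeries.coeff_zero_eq_constantCoeff, map_mul, map_add,
    map_one, map_pow, PowerSeries.constantCoeff_C] at h ⊢
  generalize PowerSeries.constantCoeff Y = y at h ⊢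
  have h1 : (y - 1) * (PowerSeries.X * y - 1) = 0 := by linear_combination -h
  rcases mul_eq_zero.1 h1 with h2 | h2
  · exact sub_eq_zero.1 h2
  · have := congrArg (PowerSeries.constantCoeff (R := ℚ)) h2
    simp at this

lemma isReducedPiece_of_equation {Y : ℚ⟦X⟧⟦X⟧} (h : ∀ r, SatisfiesEquation Y r) (r : ℕ)
    (hr : 1 ≤ r) : IsReducedPiece 1 r (PowerSeries.coeff r Y) := by
  induction r using Nat.strong_induction_on with
  | _ r ih =>
    have h0 := coeff_zero_of_equation (h 0)
    have hpow := isRationalPiece_coeff_pow (Y := Y) (r := r) fun i hi => by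
      rcases Nat.eq_zero_or_pos i with rfl | hi'
      · rw [h0]; exact isRationalPiece_one
      · exact (ih i hi hi').isRationalPiece hi'
    obtain ⟨T, e, m, hT, hY⟩ := h r
    obtain ⟨Z, rfl⟩ : ∃ Z, Y = 1 + Z := ⟨Y - 1, by ring⟩
    have hone : PowerSeries.coeff r (1 : ℚ⟦X⟧⟦X⟧) = 0 := by
      rw [PowerSeries.coeff_one, if_neg (by omega)]
    have hZ : ∀ i, 1 ≤ i → PowerSeries.coeff i (1 + Z) = PowerSeries.coeff i Z := fun i hi => by
      rw [map_add, PowerSeries.coeff_one, if_neg (by omega), zero_add]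
    have hZ0 : PowerSeries.coeff 0 Z = 0 := by simpa using h0
    have hsq : IsReducedPiece 2 r (PowerSeries.X * PowerSeries.coeff r (Z ^ 2)) := by
      rw [pow_two, PowerSeries.coeff_mul, Finset.mul_sum]
      refine IsReducedPiece.sum fun x hx => ?_
      have hx := Finset.HasAntidiagonal.mem_antidiagonal.1 hx
      rcases Nat.eq_zero_or_pos x.1 with h1 | h1
      · exact ⟨0, by simp, by simp [h1, hZ0]⟩
      rcases Nat.eq_zero_or_pos x.2 with h2 | h2
      · exact ⟨0, by simp, by simp [h2, hZ0]⟩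
      rw [← hx]
      refine IsReducedPiece.X_mul_mul h1 h2 ?_ ?_
      · rw [← hZ _ h1]; exact ih _ (by omega) h1
      · rw [← hZ _ h2]; exact ih _ (by omega) h2
    have hsum : IsReducedPiece 2 r (PowerSeries.coeff r (∑ k ∈ T, PowerSeries.X ^ (e k) *
        (PowerSeries.C PowerSeries.X * (1 + Z) ^ 2) ^ (m k))) := by
      rw [map_sum]
      refine IsReducedPiece.sum fun k hk => ?_
      obtain ⟨h1, h2, h3⟩ := hT k hk
      rw [PowerSeries.coeff_X_pow_mul', if_pos h3, mul_pow, ← map_pow, PowerSeries.coeff_C_mul,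
        ← pow_mul]
      exact (hpow _ (r - e k) (by omega)).X_pow_mul h1 h2 h3
    obtain ⟨p, hp, hp'⟩ := hsq.add hsum
    refine ⟨p, hp, ?_⟩
    rw [← hp', show 2 * r - 1 = 2 * r - 2 + 1 by omega, pow_succ', ← mul_assoc]
    congr 1
    have e1 : (1 + Z) ^ 2 = 1 + (Z + Z) + Z ^ 2 := by ring
    rw [map_add _ (1 + _), map_add _ (1 : ℚ⟦X⟧⟦X⟧), PowerSeries.coeff_C_mul,
      PowerSeries.coeff_C_mul] at hY
    have e2 : PowerSeries.coeff r ((1 + Z) ^ 2) =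
        2 * PowerSeries.coeff r (1 + Z) + PowerSeries.coeff r (Z ^ 2) := by
      rw [e1]
      simp only [map_add, hone]
      ring
    rw [e2, hone] at hY
    linear_combination hY

/-! ### The change of variables -/

/-- The substitution of `w / (1 + w) ^ 2`, as a ring homomorphism. -/
noncomputable def changeHom : ℚ⟦X⟧ →+* ℚ⟦X⟧ :=
  (PowerSeries.substAlgHom hasSubst_changeOfVariable : ℚ⟦X⟧ →ₐ[ℚ] ℚ⟦X⟧).toRingHom

lemma changeHom_apply (f : ℚ⟦X⟧) : changeHom f = f.subst changeOfVariable := by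
  rw [← PowerSeries.coe_substAlgHom hasSubst_changeOfVariable]
  rfl

lemma changeHom_X : changeHom PowerSeries.X = changeOfVariable := by
  rw [changeHom_apply, PowerSeries.subst_X hasSubst_changeOfVariable]

lemma changeOfVariable_mul : changeOfVariable * (1 + PowerSeries.X) ^ 2 = PowerSeries.X := by
  rw [changeOfVariable, mul_assoc, PowerSeries.inv_mul_cancel _ (by simp), mul_one]

lemma isReducedPiece_systemGenFun (r : ℕ) (hr : 1 ≤ r) : ∃ f, IsReducedPiece 1 r f ∧
    changeHom (PowerSeries.coeff r systemGenFun) = (1 + PowerSeries.X) * f := by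
  have hinv : (1 + PowerSeries.X : ℚ⟦X⟧) * (1 + PowerSeries.X)⁻¹ = 1 :=
    PowerSeries.mul_inv_cancel _ (by simp)
  set Y : ℚ⟦X⟧⟦X⟧ := PowerSeries.C (1 + PowerSeries.X)⁻¹ * PowerSeries.map changeHom systemGenFun
    with hY
  have hM : PowerSeries.map changeHom systemGenFun = PowerSeries.C (1 + PowerSeries.X) * Y := by
    rw [hY, ← mul_assoc, ← map_mul, hinv, map_one, one_mul]
  have hsq : PowerSeries.C changeOfVariable * (PowerSeries.map changeHom systemGenFun) ^ 2 =
      PowerSeries.C PowerSeries.X * Y ^ 2 := by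
    rw [hM, mul_pow, ← mul_assoc, ← map_pow, ← map_mul, changeOfVariable_mul]
  refine ⟨PowerSeries.coeff r Y, isReducedPiece_of_equation (fun r => ?_) r hr, ?_⟩
  · obtain ⟨T, e, m, hT, h⟩ := coeff_systemGenFun_eq r
    refine ⟨T, e, m, hT, ?_⟩
    have := congrArg changeHom h
    rw [← PowerSeries.coeff_map, ← PowerSeries.coeff_map] at this
    simp only [map_add, map_one, map_mul, map_pow, map_sum, PowerSeries.map_X, PowerSeries.map_C,
      changeHom_X, hsq] at this
    rw [← hM, this]
    simp only [map_add, map_sum]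
  · rw [← PowerSeries.coeff_map, hM, PowerSeries.coeff_C_mul]

lemma meandricNumber_eq (n k r : ℕ) (h : k + r = n) : meandricNumber n k =
    Nat.card {w : {w // IsSystemWord w} // wordSize w.1 = (r, n)} := by
  have hl : ∀ S : MeandricSystem n, wordLoops (pairWord S.upper S.lower) = S.loops := fun S =>
    wordLoops_pairWord S.upper_nc S.lower_nc
  refine Nat.card_congr (Equiv.ofBijective (fun S => ⟨⟨pairWord S.1.upper S.1.lower,
    isSystemWord_pairWord S.1.upper_nc S.1.lower_nc⟩, ?_⟩) ⟨?_, ?_⟩)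
  · refine (isSystemWord_pairWord S.1.upper_nc S.1.lower_nc).wordSize_eq_iff.2 ⟨by simp, ?_⟩
    rw [hl, S.2, h]
  · rintro ⟨⟨σ, τ, hσ, hτ⟩, hS⟩ ⟨⟨σ', τ', hσ', hτ'⟩, hS'⟩ he
    obtain ⟨rfl, rfl⟩ := pairWord_injective hσ hτ hσ' hτ' (congrArg (fun w => w.1.1) he)
    rfl
  · rintro ⟨⟨w, hw⟩, hs⟩
    obtain ⟨h1, h2⟩ := hw.wordSize_eq_iff.1 hs
    obtain ⟨σ, τ, hσ, hτ, rfl⟩ := hw.exists_pairings h1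
    refine ⟨⟨⟨σ, τ, hσ, hτ⟩, ?_⟩, rfl⟩
    have := hl ⟨σ, τ, hσ, hτ⟩
    simp only at this
    omega

lemma coeff_systemGenFun_eq_meandricSeries (r : ℕ) (hr : 1 ≤ r) :
    PowerSeries.coeff r systemGenFun = meandricSeries r := by
  ext n
  rw [systemGenFun, coeff_genFun, meandricSeries, PowerSeries.coeff_mk]
  split_ifs with h
  · rw [meandricNumber_eq n (n - r) r (by omega)]
  · have : IsEmpty {w : {w // IsSystemWord w} // wordSize w.1 = (r, n)} := by
      refine ⟨fun w => ?_⟩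
      obtain ⟨h1, h2⟩ := w.1.2.wordSize_eq_iff.1 w.2
      have h3 := w.1.2.wordLoops_pos (fun h0 => by simp [h0] at h1; omega)
      omega
    rw [Nat.card_of_isEmpty, Nat.cast_zero]

theorem theorem5p5 (r : ℕ) (hr : 1 ≤ r) :
    ∃ P : Polynomial ℚ, P.natDegree ≤ 3 * r - 3 ∧
      (meandricSeries r).subst changeOfVariable =
        PowerSeries.X ^ (r + 1) * (1 + PowerSeries.X) * ((1 - PowerSeries.X) ^ (2 * r - 1))⁻¹ *
          (P : ℚ⟦X⟧) := by
  obtain ⟨f, ⟨p, hp, hf⟩, h⟩ := isReducedPiece_systemGenFun r hr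
  refine ⟨p, hp, ?_⟩
  rw [← coeff_systemGenFun_eq_meandricSeries r hr, ← changeHom_apply, h]
  have hinv : ((1 - PowerSeries.X : ℚ⟦X⟧) ^ (2 * r - 1)) *
      ((1 - PowerSeries.X : ℚ⟦X⟧) ^ (2 * r - 1))⁻¹ = 1 :=
    PowerSeries.mul_inv_cancel _ (by simp)
  linear_combination (1 + PowerSeries.X) * ((1 - PowerSeries.X : ℚ⟦X⟧) ^ (2 * r - 1))⁻¹ * hf -
    (1 + PowerSeries.X) * f * hinv
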